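/- Let $h:[0,1]^2\to[0,\infty)$ be continuous and symmetric, with $h(x,x)=0$ for all $x\in[0,1]$ and $h(x,y)>0$ for all $x\neq y$ in $[0,1]$ (condition (C1)), and Lipschitz: there is $K_h\in(0,\infty)$ with $|h(y_1,z_1)-h(y_2,z_2)|\le K_h(|y_1-y_2|+|z_1-z_2|)$ for all $(y_1,z_1),(y_2,z_2)\in[0,1]^2$ (condition (C6)). Let $X,Y$ be real random variables on a probability space, neither of them almost surely constant, with laws $\mu_X,\mu_Y$; let $\mu_{Y|x}$ be the conditional law of $Y$ given $X=x$ and $F_Y$ the c.d.f. of $Y$. Let $(X_1,Y_1),(X_2,Y_2),\dots$ be i.i.d. copies of $(X,Y)$. For each $n$ let $(X_{(1)},Y_{[1]}),\dots,(X_{(n)},Y_{[n]})$ be the first $n$ pairs reordered such that $X_{(1)}\le\dots\le X_{(n)}$, ties being broken uniformly at random (that is, conditionally on the first $n$ pairs, the ordering is uniformly distributed on the permutations that sort the $X_i$), and let $R(y)=\sum_{j=1}^n \mathrm{I}(Y_j\le y)$. Put $$\widetilde\zeta_n^{(h)}=\frac1n\sum_{i=1}^{n-1}h\Big(\frac{R(Y_{[i]})}{n},\frac{R(Y_{[i+1]})}{n}\Big),\qquad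 \widetilde\chi_n^{(h)}=\frac1{n^2}\sum_{i=1}^n\sum_{j=1}^n h\Big(\frac{R(Y_i)}{n},\frac{R(Y_j)}{n}\Big),$$ and $\widetilde\xi_n^{(h)}=1-\widetilde\zeta_n^{(h)}/\widetilde\chi_n^{(h)}$, with $\widetilde\xi_n^{(h)}=1$ if $\widetilde\chi_n^{(h)}=0$. Then, as $n\to\infty$: (i) $\widetilde\zeta_n^{(h)}$ converges almost surely to $\widetilde\zeta^{(h)}:=\int\int\int h(F_Y(y),F_Y(z))\,d\mu_{Y|x}(y)\,d\mu_{Y|x}(z)\,d\mu_X(x)$; (ii) $\widetilde\chi_n^{(h)}$ converges almost surely to $\widetilde\chi^{(h)}:=\int\int h(F_Y(y),F_Y(z))\,d\mu_Y(y)\,d\mu_Y(z)$, and $\widetilde\chi^{(h)}>0$; (iii) $\widetilde\xi_n^{(h)}$ converges almost surely to $\xi^{(h,F_Y)}:=1-\widetilde\zeta^{(h)}/\widetilde\chi^{(h)}$. -/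

import Mathlib

open MeasureTheory ProbabilityTheory Filter Topology Set

namespace RankCorr

noncomputable section

/-- Regularity condition on `h : [0,1]² → [0,∞)`: non-negative, continuous, symmetric, zero on the
diagonal and strictly positive off the diagonal. Only the values of `h` on `[0,1]²` are used. -/
structure RegularityCondition (h : ℝ → ℝ → ℝ) : Prop where
  nonneg : ∀ x ∈ Icc (0 : ℝ) 1, ∀ y ∈ Icc (0 : ℝ) 1, 0 ≤ h x y
  continuousOn : ContinuousOn (fun p : ℝ × ℝ => h p.1 p.2) (Icc (0 : ℝ) 1 ×ˢ Icc (0 : ℝ) 1)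
  symm : ∀ x ∈ Icc (0 : ℝ) 1, ∀ y ∈ Icc (0 : ℝ) 1, h x y = h y x
  diag : ∀ x ∈ Icc (0 : ℝ) 1, h x x = 0
  pos : ∀ x ∈ Icc (0 : ℝ) 1, ∀ y ∈ Icc (0 : ℝ) 1, x ≠ y → 0 < h x y

/-- Lipschitz condition on `h` over `[0,1]²`. -/
def LipschitzCondition (h : ℝ → ℝ → ℝ) : Prop :=
  ∃ K : ℝ, 0 < K ∧
    ∀ y₁ ∈ Icc (0 : ℝ) 1, ∀ z₁ ∈ Icc (0 : ℝ) 1, ∀ y₂ ∈ Icc (0 : ℝ) 1, ∀ z₂ ∈ Icc (0 : ℝ) 1,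
      |h y₁ z₁ - h y₂ z₂| ≤ K * (|y₁ - y₂| + |z₁ - z₂|)

/-- The rank `R(t) = #{j : y_j ≤ t}` of `t` among the sample `y`. -/
def rank {n : ℕ} (y : Fin n → ℝ) (t : ℝ) : ℕ :=
  (Finset.univ.filter fun j : Fin n => y j ≤ t).card

/-- The variation statistic `(1/n) ∑_{i=1}^{n-1} h(R(Y_[i])/n, R(Y_[i+1])/n)`, where
`Y_[i] = y (s i)` (with indices starting from zero) for an ordering `s` of the sample. -/
def rankVariation (h : ℝ → ℝ → ℝ) {n : ℕ} (y : Fin n → ℝ) (s : Equiv.Perm (Fin n)) : ℝ :=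
  (1 / (n : ℝ)) * ∑ i : Fin (n - 1),
    h ((rank y (y (s ⟨i.1, by omega⟩)) : ℝ) / n) ((rank y (y (s ⟨i.1 + 1, by omega⟩)) : ℝ) / n)

/-- The normalization statistic `(1/n²) ∑_i ∑_j h(R(Y_i)/n, R(Y_j)/n)`. -/
def rankNormalization (h : ℝ → ℝ → ℝ) {n : ℕ} (y : Fin n → ℝ) : ℝ :=
  (1 / (n : ℝ) ^ 2) * ∑ i : Fin n, ∑ j : Fin n,
    h ((rank y (y i) : ℝ) / n) ((rank y (y j) : ℝ) / n)

/-- The rank-based correlation coefficient, equal to `1` if the normalization vanishes. -/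
def rankCoefficient (h : ℝ → ℝ → ℝ) {n : ℕ} (y : Fin n → ℝ) (s : Equiv.Perm (Fin n)) : ℝ :=
  if rankNormalization h y = 0 then 1 else 1 - rankVariation h y s / rankNormalization h y

/-- The orderings `s` of the sample with `x (s 0) ≤ x (s 1) ≤ …`. -/
def sortingPerms {n : ℕ} (x : Fin n → ℝ) : Set (Equiv.Perm (Fin n)) :=
  {s | Monotone fun i => x (s i)}

open Classical in
/-- `s` is a random ordering of the sample `(X_i, Y_i)`, `i : Fin n`, that sorts the `X_i`, ties
being broken uniformly at random: conditionally on the sample, `s` is uniformly distributed on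
the set of all orderings that sort the `X_i`. -/
structure IsRandomSorting {Ω : Type*} [MeasurableSpace Ω] (P : Measure Ω) {n : ℕ}
    (X Y : Fin n → Ω → ℝ) (s : Ω → Equiv.Perm (Fin n)) : Prop where
  measurableSet_eq : ∀ t : Equiv.Perm (Fin n), MeasurableSet {ω | s ω = t}
  condProb_eq : ∀ t : Equiv.Perm (Fin n),
    P[{ω | s ω = t}.indicator (fun _ => (1 : ℝ)) |
        MeasurableSpace.comap (fun ω (i : Fin n) => (X i ω, Y i ω)) inferInstance]
      =ᵐ[P] fun ω => if t ∈ sortingPerms (fun i => X i ω)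
        then 1 / ((sortingPerms fun i => X i ω).ncard : ℝ) else 0

/-- `∫∫∫ h(F(y), F(z)) dμ_{Y|x}(y) dμ_{Y|x}(z) dμ_X(x)`. -/
def variationLimit {Ω : Type*} [MeasurableSpace Ω] (P : Measure Ω) [IsFiniteMeasure P]
    (h : ℝ → ℝ → ℝ) (F : ℝ → ℝ) (X Y : Ω → ℝ) : ℝ :=
  ∫ x, ∫ z, ∫ y, h (F y) (F z) ∂(condDistrib Y X P x) ∂(condDistrib Y X P x) ∂(P.map X)

/-- `∫∫ h(F(y), F(z)) dμ_Y(y) dμ_Y(z)`. -/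
def normalizationLimit {Ω : Type*} [MeasurableSpace Ω] (P : Measure Ω)
    (h : ℝ → ℝ → ℝ) (F : ℝ → ℝ) (Y : Ω → ℝ) : ℝ :=
  ∫ z, ∫ y, h (F y) (F z) ∂(P.map Y) ∂(P.map Y)

/-- The correlation measure `ξ^{(h,F)}`, equal to `1` if its denominator vanishes. -/
def correlationMeasure {Ω : Type*} [MeasurableSpace Ω] (P : Measure Ω) [IsFiniteMeasure P]
    (h : ℝ → ℝ → ℝ) (F : ℝ → ℝ) (X Y : Ω → ℝ) : ℝ :=
  if normalizationLimit P h F Y = 0 then 1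
  else 1 - variationLimit P h F X Y / normalizationLimit P h F Y

end

end RankCorr

/-! ### Exponential moments along a fixed ordering -/

namespace RankCorr

/-! By Glivenko–Cantelli (`IsIIDSample.ae_eventually_abs_rank_sub_le`) and the Lipschitz condition,
ranks divided by `n` may be replaced by `F_Y`. The Lipschitz condition also makes `h (F y) (F z)` a
uniform limit of finite sums of products `φ y * ψ z`. Both statistics are contractions for the sup
norm, so only products need a limit theorem.

For the normalization, the double sum of a product factors into two means, and the strong law
applies. For the variation, `IsIIDSample.ae_tendsto_adjacent_mul` writes `φ (Y) = A (X) + ε` and `ψ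
(Y) = B (X) + δ`, with `A`, `B` the conditional means given `X`, and expands the product over
neighbours into `A (X_a) ψ (Y_b) + ε_a B (X_b) + ε_a δ_b`. A bounded measurable function of `X` is
close in `L¹` to a continuous compactly supported one, which varies little along sorted points; so
in the first two terms `X_a` and `X_b` are interchangeable, and the strong law gives the limits `∫ A
B` and `0`.

The third term is a sum of martingale-difference type: the law of the ordering given the sample
depends on the `X_i` only, so each new `δ` stays centred. A Chernoff bound gives geometric tails
(`IsRandomSorting.measureReal_adjacentSum_ge_le`), and Borel–Cantelli finishes.

Finally `χ = 0` would force `F_Y` to be constant almost everywhere, hence `Y` too. -/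

/-- The sum of `q a b` over pairs `(a, b)` of consecutive elements in the ordering `s`. -/
def adjacentSum {n : ℕ} (q : Fin n → Fin n → ℝ) (s : Equiv.Perm (Fin n)) : ℝ :=
  ∑ i : Fin (n - 1), q (s ⟨i.1, by omega⟩) (s ⟨i.1 + 1, by omega⟩)

/-- `d` is orthogonal to all bounded measurable functions of the first coordinate. -/
def FstCentered (μ : Measure (ℝ × ℝ)) (d : ℝ × ℝ → ℝ) : Prop :=
  ∀ H : ℝ → ℝ, Measurable H → (∃ C, ∀ x, |H x| ≤ C) → ∫ p, H p.1 * d p ∂μ = 0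

lemma integrable_of_abs_le {α : Type*} [MeasurableSpace α] {μ : Measure α} [IsFiniteMeasure μ]
    {f : α → ℝ} (hf : Measurable f) {C : ℝ} (hC : ∀ x, |f x| ≤ C) : Integrable f μ :=
  Integrable.of_bound hf.aestronglyMeasurable C (ae_of_all _ hC)

/-- Fubini: with all coordinates but `j` frozen, `H` is a bounded measurable function of `(w j).1`,
so centredness kills the inner integral. -/
lemma integral_pi_mul_eq_zero {n : ℕ} {μ : Measure (ℝ × ℝ)} [IsProbabilityMeasure μ]
    {d : ℝ × ℝ → ℝ} (hd : Measurable d) (hdb : ∃ C, ∀ p, |d p| ≤ C) (hc : FstCentered μ d)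
    (j : Fin n) {H : (Fin n → ℝ × ℝ) → ℝ} (hH : Measurable H) (hHb : ∃ C, ∀ w, |H w| ≤ C)
    (hHj : ∀ w w', (∀ i, i ≠ j → w i = w' i) → (w j).1 = (w' j).1 → H w = H w') :
    ∫ w, H w * d (w j) ∂(Measure.pi fun _ => μ) = 0 := by
  obtain ⟨m, rfl⟩ : ∃ m, n = m + 1 := ⟨n - 1, by have := j.2; omega⟩
  obtain ⟨C, hC⟩ := hHb
  obtain ⟨D, hD⟩ := hdb
  have hint : Integrable (fun w : Fin (m + 1) → ℝ × ℝ => H w * d (w j))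
      (Measure.pi fun _ => μ) := by
    refine integrable_of_abs_le (C := C * D) (by fun_prop) fun w => ?_
    rw [abs_mul]
    exact mul_le_mul (hC w) (hD _) (abs_nonneg _) ((abs_nonneg _).trans (hC w))
  have hmp := (measurePreserving_piFinSuccAbove (fun _ : Fin (m + 1) => μ) j).symm
  rw [← hmp.integral_comp']
  have hint' := (hmp.integrable_comp_emb (MeasurableEquiv.measurableEmbedding _)).2 hint
  simp only [Function.comp_def] at hint'
  rw [integral_prod_symm _ hint']
  refine integral_eq_zero_of_ae (ae_of_all _ fun r => ?_)
  simp only [MeasurableEquiv.piFinSuccAbove_symm_apply, Fin.insertNthEquiv_apply,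
    Fin.insertNth_apply_same, Pi.zero_apply]
  have h1 : ∀ p : ℝ × ℝ, H (j.insertNth p r) = H (j.insertNth (p.1, (0 : ℝ)) r) := by
    intro p
    refine hHj _ _ (fun i hi => ?_) (by simp)
    obtain ⟨k, rfl⟩ := Fin.exists_succAbove_eq hi
    simp
  refine (integral_congr_ae (ae_of_all _ fun p => congrArg (· * d p) (h1 p))).trans ?_
  refine hc (fun x => H (j.insertNth (x, (0 : ℝ)) r)) ?_ ⟨C, fun x => hC _⟩
  refine hH.comp (measurable_pi_iff.2 fun i => ?_)
  obtain rfl | hi := eq_or_ne i j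
  · simpa using measurable_id.prodMk measurable_const
  · obtain ⟨k, rfl⟩ := Fin.exists_succAbove_eq hi
    simp

/-- A supermartingale argument: each further summand costs a factor `cosh l`. The weight `c` will be
the conditional probability of the ordering `t`; since it depends on first coordinates only, it does
not disturb the centring of `d`. -/
lemma integral_exp_adjacent_le {n : ℕ} {μ : Measure (ℝ × ℝ)} [IsProbabilityMeasure μ]
    {e d : ℝ × ℝ → ℝ} (he : Measurable e) (hd : Measurable d) (heb : ∀ p, |e p| ≤ 1)
    (hdb : ∀ p, |d p| ≤ 1) (hc : FstCentered μ d) (t : Equiv.Perm (Fin n))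
    {c : (Fin n → ℝ) → ℝ} (hcm : Measurable c) (hc0 : ∀ x, 0 ≤ c x) (hc1 : ∀ x, c x ≤ 1) (l : ℝ)
    (k : ℕ) (hk : k ≤ n - 1) :
    ∫ w, c (fun i => (w i).1) * Real.exp (l * ∑ i : Fin k,
        e (w (t ⟨i.1, by omega⟩)) * d (w (t ⟨i.1 + 1, by omega⟩))) ∂(Measure.pi fun _ => μ)
      ≤ Real.cosh l ^ k * ∫ w, c (fun i => (w i).1) ∂(Measure.pi fun _ => μ) := by
  induction k with
  | zero => simp
  | succ k ih =>
    set π : Measure (Fin n → ℝ × ℝ) := Measure.pi fun _ => μ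
    specialize ih (by omega)
    have hx : ∀ w : Fin n → ℝ × ℝ, ∀ a b : Fin n, |e (w a) * d (w b)| ≤ 1 := fun w a b => by
      rw [abs_mul]; exact mul_le_one₀ (heb _) (abs_nonneg _) (hdb _)
    set G : (Fin n → ℝ × ℝ) → ℝ := fun w => c (fun i => (w i).1) * Real.exp (l * ∑ i : Fin k,
        e (w (t ⟨i.1, by omega⟩)) * d (w (t ⟨i.1 + 1, by omega⟩))) with hG
    have hGm : Measurable G := by fun_prop
    have hG0 : ∀ w, 0 ≤ G w := fun w => mul_nonneg (hc0 _) (Real.exp_pos _).le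
    have hGb : ∀ w, |G w| ≤ Real.exp (|l| * k) := by
      intro w
      rw [abs_of_nonneg (hG0 w), ← one_mul (Real.exp (|l| * k))]
      refine mul_le_mul (hc1 _) (Real.exp_le_exp.2 ?_) (Real.exp_pos _).le zero_le_one
      refine (le_abs_self _).trans ?_
      rw [abs_mul]
      refine mul_le_mul_of_nonneg_left ?_ (abs_nonneg _)
      refine (Finset.abs_sum_le_sum_abs _ _).trans ?_
      refine (Finset.sum_le_sum fun i _ => hx w _ _).trans ?_
      simp
    set a : Fin n := t ⟨k, by omega⟩ with ha
    set b : Fin n := t ⟨k + 1, by omega⟩ with hb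
    have hab : a ≠ b := fun h => by simpa using t.injective h
    have hGe : ∀ w, |G w * e (w a)| ≤ Real.exp (|l| * k) := fun w => by
      rw [abs_mul]; exact (mul_le_of_le_one_right (abs_nonneg _) (heb _)).trans (hGb w)
    have hGed : ∀ w, |G w * e (w a) * d (w b)| ≤ Real.exp (|l| * k) := fun w => by
      rw [abs_mul]; exact (mul_le_of_le_one_right (abs_nonneg _) (hdb _)).trans (hGe w)
    -- Apart from `d (w b)`, the integrand sees `w b` only through `c`: the sum and `e (w a)` use
    -- the indices `t 0, …, t k`, all distinct from `b = t (k + 1)`.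
    have hz : ∫ w, G w * e (w a) * d (w b) ∂π = 0 := by
      refine integral_pi_mul_eq_zero hd ⟨1, hdb⟩ hc b (H := fun w => G w * e (w a))
        (by fun_prop) ⟨_, hGe⟩ fun w w' h1 h2 => ?_
      have h3 : (fun i => (w i).1) = fun i => (w' i).1 := by
        funext i
        by_cases hi : i = b
        · rw [hi, h2]
        · rw [h1 i hi]
      have h4 : ∀ m (hm : m ≤ k), w (t ⟨m, by omega⟩) = w' (t ⟨m, by omega⟩) := fun m hm => by
        refine h1 _ fun h => ?_
        have := t.injective h
        simp only [Fin.mk.injEq] at this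
        omega
      simp only [hG, h3]
      rw [h4 k le_rfl]
      congr 4
      refine Finset.sum_congr rfl fun i _ => ?_
      rw [h4 i.1 i.2.le, h4 (i.1 + 1) i.2]
    have hi1 : Integrable G π := integrable_of_abs_le hGm hGb
    have hi2 : Integrable (fun w => G w * e (w a) * d (w b)) π :=
      integrable_of_abs_le (by fun_prop) hGed
    -- Convexity bounds `exp (l x)` on `[-1, 1]` by its chord `cosh l + x sinh l`; the linear part
    -- integrates to zero by `hz`.
    have hpt : ∀ w, c (fun i => (w i).1) * Real.exp (l * ∑ i : Fin (k + 1),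
        e (w (t ⟨i.1, by omega⟩)) * d (w (t ⟨i.1 + 1, by omega⟩)))
        ≤ Real.cosh l * G w + Real.sinh l * (G w * e (w a) * d (w b)) := by
      intro w
      rw [Fin.sum_univ_castSucc, mul_add, Real.exp_add, ← mul_assoc]
      have := Real.exp_mul_le_cosh_add_mul_sinh (hx w a b) l
      rw [mul_comm _ l] at this
      calc _ ≤ G w * (Real.cosh l + e (w a) * d (w b) * Real.sinh l) :=
            mul_le_mul_of_nonneg_left this (hG0 w)
        _ = _ := by ring
    refine (integral_mono_of_nonneg (ae_of_all _ fun w => mul_nonneg (hc0 _) (Real.exp_pos _).le)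
      ((hi1.const_mul _).add (hi2.const_mul _)) (ae_of_all _ hpt)).trans ?_
    simp only [Pi.add_apply]
    rw [integral_add (hi1.const_mul _) (hi2.const_mul _), integral_const_mul, integral_const_mul,
      hz, mul_zero, add_zero, pow_succ', mul_assoc]
    exact mul_le_mul_of_nonneg_left ih (Real.cosh_pos l).le

end RankCorr

/-! ### Random orderings and the tail bound -/

namespace RankCorr

open Classical in
/-- The conditional probability, given the values `x`, of the ordering `t`. -/
noncomputable def sortWeight {n : ℕ} (t : Equiv.Perm (Fin n)) (x : Fin n → ℝ) : ℝ :=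
  if t ∈ sortingPerms x then 1 / ((sortingPerms x).ncard : ℝ) else 0

lemma measurableSet_mem_sortingPerms {n : ℕ} (t : Equiv.Perm (Fin n)) :
    MeasurableSet {x : Fin n → ℝ | t ∈ sortingPerms x} := by
  have : {x : Fin n → ℝ | t ∈ sortingPerms x} =
      ⋂ (i : Fin n) (j : Fin n) (_ : i ≤ j), {x | x (t i) ≤ x (t j)} := by
    ext x; simp [sortingPerms, Monotone]
  rw [this]
  exact MeasurableSet.iInter fun i => MeasurableSet.iInter fun j => MeasurableSet.iInter fun _ =>
    measurableSet_le (measurable_pi_apply _) (measurable_pi_apply _)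

lemma measurable_sortWeight {n : ℕ} (t : Equiv.Perm (Fin n)) : Measurable (sortWeight t) := by
  classical
  refine Measurable.ite (measurableSet_mem_sortingPerms t) ?_ measurable_const
  have : (fun x : Fin n → ℝ => ((sortingPerms x).ncard : ℝ)) =
      fun x => ∑ u : Equiv.Perm (Fin n), if u ∈ sortingPerms x then (1 : ℝ) else 0 := by
    funext x
    rw [Set.ncard_eq_toFinset_card', Finset.sum_boole]
    congr 2
    ext u; simp
  have hm : Measurable fun x : Fin n → ℝ => ((sortingPerms x).ncard : ℝ) := by
    rw [this]
    exact Finset.measurable_sum _ fun u _ =>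
      Measurable.ite (measurableSet_mem_sortingPerms u) measurable_const measurable_const
  exact measurable_const.div hm

lemma sortWeight_nonneg {n : ℕ} (t : Equiv.Perm (Fin n)) (x : Fin n → ℝ) :
    0 ≤ sortWeight t x := by
  unfold sortWeight; split_ifs <;> positivity

lemma sortWeight_le_one {n : ℕ} (t : Equiv.Perm (Fin n)) (x : Fin n → ℝ) :
    sortWeight t x ≤ 1 := by
  unfold sortWeight
  split_ifs
  · rw [one_div]; exact Nat.cast_inv_le_one _
  · exact zero_le_one

variable {Ω : Type*} {mΩ : MeasurableSpace Ω} {P : Measure Ω}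

/-- The pull-out property of conditional expectation. It trades the event `s = t` for a weight that
depends on the `X_i` only. -/
lemma IsRandomSorting.integral_indicator_mul [IsProbabilityMeasure P] {n : ℕ}
    {X Y : Fin n → Ω → ℝ} {s : Ω → Equiv.Perm (Fin n)} (hs : IsRandomSorting P X Y s)
    (hX : ∀ i, Measurable (X i)) (hY : ∀ i, Measurable (Y i)) (t : Equiv.Perm (Fin n))
    {Φ : (Fin n → ℝ × ℝ) → ℝ} (hΦ : Measurable Φ) {C : ℝ} (hC : ∀ w, |Φ w| ≤ C) :
    ∫ ω, {ω | s ω = t}.indicator (fun _ => (1 : ℝ)) ω * Φ (fun i => (X i ω, Y i ω)) ∂P =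
      ∫ ω, sortWeight t (fun i => X i ω) * Φ (fun i => (X i ω, Y i ω)) ∂P := by
  have hZ : Measurable fun ω (i : Fin n) => (X i ω, Y i ω) := by fun_prop
  have hle := hZ.comap_le
  have hΦm : StronglyMeasurable[MeasurableSpace.comap
      (fun ω (i : Fin n) => (X i ω, Y i ω)) inferInstance] fun ω => Φ (fun i => (X i ω, Y i ω)) :=
    (hΦ.comp (comap_measurable fun ω (i : Fin n) => (X i ω, Y i ω))).stronglyMeasurable
  have hind : Integrable ({ω | s ω = t}.indicator (fun _ => (1 : ℝ))) P :=
    (integrable_const 1).indicator (hs.measurableSet_eq t)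
  have h1 := condExp_stronglyMeasurable_mul_of_bound hle hΦm hind C (ae_of_all _ fun ω => hC _)
  rw [← integral_congr_ae (ae_of_all _ fun ω => mul_comm (Φ fun i => (X i ω, Y i ω)) _)]
  rw [← integral_condExp hle]
  refine integral_congr_ae ?_
  filter_upwards [h1, hs.condProb_eq t] with ω h2 h3
  refine h2.trans ?_
  rw [Pi.mul_apply, h3, mul_comm]
  rfl

lemma IsRandomSorting.ae_mem_sortingPerms [IsProbabilityMeasure P] {n : ℕ}
    {X Y : Fin n → Ω → ℝ} {s : Ω → Equiv.Perm (Fin n)} (hs : IsRandomSorting P X Y s)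
    (hX : ∀ i, Measurable (X i)) (hY : ∀ i, Measurable (Y i)) :
    ∀ᵐ ω ∂P, s ω ∈ sortingPerms fun i => X i ω := by
  have key : ∀ t, ∀ᵐ ω ∂P, s ω = t → t ∈ sortingPerms fun i => X i ω := by
    intro t
    have hB : MeasurableSet {w : Fin n → ℝ × ℝ | t ∉ sortingPerms fun i => (w i).1} :=
      (measurableSet_mem_sortingPerms t).compl.preimage
        (f := fun (w : Fin n → ℝ × ℝ) i => (w i).1) (by fun_prop)
    have h := hs.integral_indicator_mul hX hY t
      (Φ := {w : Fin n → ℝ × ℝ | t ∉ sortingPerms fun i => (w i).1}.indicator fun _ => (1 : ℝ))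
      (measurable_const.indicator hB) (C := 1)
      (fun w => by by_cases hw : t ∈ sortingPerms (fun i => (w i).1) <;> simp [hw])
    have h0 : ∀ ω, sortWeight t (fun i => X i ω) *
        {w : Fin n → ℝ × ℝ | t ∉ sortingPerms fun i => (w i).1}.indicator (fun _ => (1 : ℝ))
          (fun i => (X i ω, Y i ω)) = 0 := by
      intro ω
      by_cases hw : t ∈ sortingPerms (fun i => X i ω) <;> simp [hw, sortWeight]
    rw [integral_congr_ae (ae_of_all _ h0), integral_zero, integral_eq_zero_iff_of_nonneg_ae] at h
    · filter_upwards [h] with ω hω hst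
      by_contra hn
      simp [hst, hn] at hω
    · refine ae_of_all _ fun ω => mul_nonneg ?_ ?_ <;>
        exact Set.indicator_nonneg (fun _ _ => zero_le_one) _
    · refine integrable_of_abs_le (C := 1) ?_ fun ω => ?_
      · refine (measurable_const.indicator (hs.measurableSet_eq t)).mul ?_
        exact (measurable_const.indicator hB).comp
          (f := fun ω (i : Fin n) => (X i ω, Y i ω)) (by fun_prop)
      · by_cases hw : t ∈ sortingPerms (fun i => X i ω) <;> by_cases h' : s ω = t <;> simp [hw, h']
  filter_upwards [ae_all_iff.2 key] with ω hω using hω _ rfl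

/-- Chernoff's bound on each event `s = t`. The bound carries the factor `P (s = t)`, so summing
over all orderings costs no factor `n!`. -/
lemma IsRandomSorting.measureReal_adjacentSum_ge_le [IsProbabilityMeasure P] {n : ℕ}
    {X Y : Fin n → Ω → ℝ} {s : Ω → Equiv.Perm (Fin n)} (hs : IsRandomSorting P X Y s)
    (hX : ∀ i, Measurable (X i)) (hY : ∀ i, Measurable (Y i))
    {μ : Measure (ℝ × ℝ)} [IsProbabilityMeasure μ]
    (hpi : P.map (fun ω (i : Fin n) => (X i ω, Y i ω)) = Measure.pi fun _ => μ)
    {e d : ℝ × ℝ → ℝ} (he : Measurable e) (hd : Measurable d) (heb : ∀ p, |e p| ≤ 1)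
    (hdb : ∀ p, |d p| ≤ 1) (hc : FstCentered μ d) {η : ℝ} (hη : 0 < η) :
    P.real {ω | n * η ≤ adjacentSum (fun a b => e (X a ω, Y a ω) * d (X b ω, Y b ω)) (s ω)}
      ≤ Real.exp (-(η ^ 2 / 2)) ^ n := by
  have hZ : Measurable fun ω (i : Fin n) => (X i ω, Y i ω) := by fun_prop
  set S : Equiv.Perm (Fin n) → Ω → ℝ := fun t ω =>
    adjacentSum (fun a b => e (X a ω, Y a ω) * d (X b ω, Y b ω)) t with hS
  have hSm : ∀ t, Measurable (S t) := fun t => by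
    simp only [hS, adjacentSum]; fun_prop
  have hset : ∀ t, MeasurableSet {ω | s ω = t ∧ n * η ≤ S t ω} := fun t =>
    (hs.measurableSet_eq t).inter (measurableSet_le measurable_const (hSm t))
  have key : ∀ t, P.real {ω | s ω = t ∧ n * η ≤ S t ω} ≤
      Real.exp (-(η ^ 2 / 2)) ^ n * P.real {ω | s ω = t} := by
    intro t
    have hsm := measurable_sortWeight t
    have hcm : Measurable fun w : Fin n → ℝ × ℝ => sortWeight t fun i => (w i).1 :=
      hsm.comp (by fun_prop)
    have hΦb : ∀ w : Fin n → ℝ × ℝ, |Real.exp (η * ∑ i : Fin (n - 1),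
        e (w (t ⟨i.1, by omega⟩)) * d (w (t ⟨i.1 + 1, by omega⟩)))| ≤ Real.exp (η * n) := by
      intro w
      rw [abs_of_pos (Real.exp_pos _)]
      refine Real.exp_le_exp.2 (mul_le_mul_of_nonneg_left ?_ hη.le)
      refine (le_abs_self _).trans ((Finset.abs_sum_le_sum_abs _ _).trans ?_)
      refine (Finset.sum_le_sum fun i _ => (abs_mul _ _).trans_le
        (mul_le_one₀ (heb _) (abs_nonneg _) (hdb _))).trans ?_
      simp
    have h1 := hs.integral_indicator_mul hX hY t (Φ := fun w => Real.exp (η * ∑ i : Fin (n - 1),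
        e (w (t ⟨i.1, by omega⟩)) * d (w (t ⟨i.1 + 1, by omega⟩)))) (by fun_prop) hΦb
    -- The choice `l = η` minimises `n l² / 2 - l n η`, which comes from `cosh l ≤ exp (l² / 2)`.
    have h2 := integral_exp_adjacent_le he hd heb hdb hc t hsm
      (sortWeight_nonneg t) (sortWeight_le_one t) η (n - 1) le_rfl
    -- With `Φ = 1` the integrated weight is identified as `P (s = t)`.
    have h3 := hs.integral_indicator_mul hX hY t (Φ := fun _ => 1) measurable_const (C := 1)
      (by simp)
    simp only [mul_one] at h3
    rw [integral_indicator_const _ (hs.measurableSet_eq t), smul_eq_mul, mul_one] at h3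
    rw [← hpi, integral_map hZ.aemeasurable (Measurable.aestronglyMeasurable (by fun_prop)),
      integral_map hZ.aemeasurable hcm.aestronglyMeasurable] at h2
    change (∫ ω, (sortWeight t fun i => X i ω) * Real.exp (η * S t ω) ∂P) ≤
      Real.cosh η ^ (n - 1) * ∫ ω, (sortWeight t fun i => X i ω) ∂P at h2
    rw [← h3] at h2
    replace h2 := h1.trans_le h2
    have hind : Measurable ({ω | s ω = t}.indicator (fun _ => (1 : ℝ))) :=
      measurable_const.indicator (hs.measurableSet_eq t)
    have h4 : P.real {ω | s ω = t ∧ n * η ≤ S t ω} * Real.exp (η * (n * η)) ≤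
        ∫ ω, {ω | s ω = t}.indicator (fun _ => (1 : ℝ)) ω * Real.exp (η * S t ω) ∂P := by
      rw [← smul_eq_mul, ← integral_indicator_const _ (hset t)]
      refine integral_mono ((integrable_const _).indicator (hset t)) ?_ fun ω => ?_
      · refine integrable_of_abs_le (C := Real.exp (η * n)) (by fun_prop) fun ω => ?_
        rw [abs_mul]
        refine (mul_le_of_le_one_left (abs_nonneg _) ?_).trans
          (hΦb fun i => (X i ω, Y i ω))
        by_cases h : s ω = t <;> simp [h]
      · by_cases h : s ω = t
        · by_cases h' : n * η ≤ S t ω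
          · simpa [h, h'] using mul_le_mul_of_nonneg_left h' hη.le
          · simpa [h, h'] using (Real.exp_pos _).le
        · simp [h]
    have h5 : Real.cosh η ^ (n - 1) ≤ Real.exp (η ^ 2 / 2) ^ n :=
      (pow_le_pow_left₀ (Real.cosh_pos η).le (Real.cosh_le_exp_half_sq η) _).trans
        (pow_le_pow_right₀ (Real.one_le_exp (by positivity)) (Nat.sub_le _ _))
    have h6 := (h4.trans h2).trans (mul_le_mul_of_nonneg_right h5 measureReal_nonneg)
    rw [← le_div_iff₀ (Real.exp_pos _)] at h6
    refine h6.trans_eq ?_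
    rw [← Real.exp_nat_mul, ← Real.exp_nat_mul, mul_div_right_comm, ← Real.exp_sub]
    congr 2
    ring
  calc P.real {ω | n * η ≤ S (s ω) ω}
      ≤ P.real (⋃ t, {ω | s ω = t ∧ n * η ≤ S t ω}) :=
        measureReal_mono fun ω hω => mem_iUnion.2 ⟨s ω, rfl, hω⟩
    _ ≤ ∑ t, P.real {ω | s ω = t ∧ n * η ≤ S t ω} := measureReal_iUnion_fintype_le _
    _ ≤ ∑ t, Real.exp (-(η ^ 2 / 2)) ^ n * P.real {ω | s ω = t} :=
        Finset.sum_le_sum fun t _ => key t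
    _ = Real.exp (-(η ^ 2 / 2)) ^ n := by
      have h7 : ∑ t, P.real {ω | s ω = t} = 1 := by
        have := sum_measureReal_preimage_singleton (μ := P) (f := s) Finset.univ
          (fun t _ => hs.measurableSet_eq t)
        simpa [preimage] using this
      rw [← Finset.mul_sum, h7, mul_one]

end RankCorr

/-! ### Deterministic estimates for adjacent sums -/

namespace RankCorr

lemma adjacentSum_left_le {n : ℕ} {u : Fin n → ℝ} (hu : ∀ i, 0 ≤ u i) (s : Equiv.Perm (Fin n)) :
    adjacentSum (fun a _ => u a) s ≤ ∑ i, u i := by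
  rw [← Equiv.sum_comp s]
  cases n with
  | zero => simp [adjacentSum]
  | succ m =>
    rw [Fin.sum_univ_castSucc]
    exact le_add_of_nonneg_right (hu _)

lemma adjacentSum_right_le {n : ℕ} {u : Fin n → ℝ} (hu : ∀ i, 0 ≤ u i) (s : Equiv.Perm (Fin n)) :
    adjacentSum (fun _ b => u b) s ≤ ∑ i, u i := by
  rw [← Equiv.sum_comp s]
  cases n with
  | zero => simp [adjacentSum]
  | succ m =>
    rw [Fin.sum_univ_succ]
    exact le_add_of_nonneg_left (hu _)

/-- Left neighbours run through every index except the one in last position; right neighbours, in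
the next lemma, miss only the first position. -/
lemma abs_adjacentSum_left_sub_le {n : ℕ} {u : Fin n → ℝ} {C : ℝ} (hC : 0 ≤ C)
    (hu : ∀ i, |u i| ≤ C) (s : Equiv.Perm (Fin n)) :
    |adjacentSum (fun a _ => u a) s - ∑ i, u i| ≤ C := by
  rw [← Equiv.sum_comp s]
  cases n with
  | zero => simpa [adjacentSum] using hC
  | succ m =>
    rw [Fin.sum_univ_castSucc, abs_sub_comm]
    change |∑ i : Fin m, u (s i.castSucc) + _ - ∑ i : Fin m, u (s i.castSucc)| ≤ C
    rw [add_sub_cancel_left]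
    exact hu _

lemma abs_adjacentSum_right_sub_le {n : ℕ} {u : Fin n → ℝ} {C : ℝ} (hC : 0 ≤ C)
    (hu : ∀ i, |u i| ≤ C) (s : Equiv.Perm (Fin n)) :
    |adjacentSum (fun _ b => u b) s - ∑ i, u i| ≤ C := by
  rw [← Equiv.sum_comp s]
  cases n with
  | zero => simpa [adjacentSum] using hC
  | succ m =>
    rw [Fin.sum_univ_succ, abs_sub_comm]
    change |_ + ∑ i : Fin m, u (s i.succ) - ∑ i : Fin m, u (s i.succ)| ≤ C
    rw [add_sub_cancel_right]
    exact hu _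

lemma adjacentSum_mono {n : ℕ} {q r : Fin n → Fin n → ℝ} (h : ∀ a b, q a b ≤ r a b)
    (s : Equiv.Perm (Fin n)) : adjacentSum q s ≤ adjacentSum r s :=
  Finset.sum_le_sum fun _ _ => h _ _

lemma abs_adjacentSum_le {n : ℕ} (q : Fin n → Fin n → ℝ) (s : Equiv.Perm (Fin n)) :
    |adjacentSum q s| ≤ adjacentSum (fun a b => |q a b|) s :=
  Finset.abs_sum_le_sum_abs _ _

lemma adjacentSum_add {n : ℕ} (q r : Fin n → Fin n → ℝ) (s : Equiv.Perm (Fin n)) :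
    adjacentSum (fun a b => q a b + r a b) s = adjacentSum q s + adjacentSum r s :=
  Finset.sum_add_distrib

lemma adjacentSum_sub {n : ℕ} (q r : Fin n → Fin n → ℝ) (s : Equiv.Perm (Fin n)) :
    adjacentSum (fun a b => q a b - r a b) s = adjacentSum q s - adjacentSum r s :=
  Finset.sum_sub_distrib _ _

lemma adjacentSum_const_mul {n : ℕ} (c : ℝ) (q : Fin n → Fin n → ℝ) (s : Equiv.Perm (Fin n)) :
    adjacentSum (fun a b => c * q a b) s = c * adjacentSum q s :=
  (Finset.mul_sum _ _ _).symm

lemma adjacentSum_sum {n : ℕ} {ι : Type*} (t : Finset ι) (q : ι → Fin n → Fin n → ℝ)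
    (s : Equiv.Perm (Fin n)) :
    adjacentSum (fun a b => ∑ k ∈ t, q k a b) s = ∑ k ∈ t, adjacentSum (q k) s :=
  Finset.sum_comm

lemma adjacentSum_const_le {n : ℕ} {c : ℝ} (hc : 0 ≤ c) (s : Equiv.Perm (Fin n)) :
    adjacentSum (fun _ _ => c) s ≤ n * c := by
  simpa using adjacentSum_left_le (fun _ => hc) s

/-- Monotonicity removes the absolute values, and the sum telescopes. -/
lemma adjacentSum_abs_sub_le_of_monotone {n : ℕ} {φ : Fin n → ℝ} {s : Equiv.Perm (Fin n)}
    (hφ : Monotone fun i => φ (s i)) {M : ℝ} (hM : 0 ≤ M) (hb : ∀ i, |φ i| ≤ M) :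
    adjacentSum (fun a b => |φ b - φ a|) s ≤ 2 * M := by
  have h : adjacentSum (fun a b => |φ b - φ a|) s = adjacentSum (fun a b => φ b - φ a) s :=
    Finset.sum_congr rfl fun i _ => abs_of_nonneg (sub_nonneg.2 (hφ (Fin.mk_le_mk.2 (by omega))))
  rw [h, adjacentSum_sub (fun _ b => φ b) (fun a _ => φ a)]
  have h1 := abs_adjacentSum_left_sub_le hM hb s
  have h2 := abs_adjacentSum_right_sub_le hM hb s
  rw [abs_le] at h1 h2
  linarith [h1.1, h2.2]

/-- The total variation of a continuous compactly supported function along sorted points is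
negligible compared to the number of points. -/
lemma exists_adjacentSum_abs_sub_le {g : ℝ → ℝ} (hg : Continuous g) (hgs : HasCompactSupport g)
    {η : ℝ} (hη : 0 < η) :
    ∃ K : ℝ, ∀ (n : ℕ) (x : Fin n → ℝ) (s : Equiv.Perm (Fin n)), s ∈ sortingPerms x →
      adjacentSum (fun a b => |g (x b) - g (x a)|) s ≤ n * η + K := by
  obtain ⟨C, hC⟩ := hgs.exists_bound_of_continuous hg
  have hC0 : 0 ≤ C := (norm_nonneg _).trans (hC 0)
  obtain ⟨δ, hδ, huc⟩ := Metric.uniformContinuous_iff.1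
    (hgs.uniformContinuous_of_continuous hg) η hη
  obtain ⟨M, hM⟩ := hgs.isCompact.isBounded.subset_closedBall 0
  set R := |M| + 1
  have hR : 0 ≤ R := by positivity
  -- Clamping to `[-R, R]`: `g` vanishes where `|x| ≥ R`, so `g ∘ φ = g`, while the clamped points
  -- stay sorted and have total variation at most `2 * R`.
  set φ : ℝ → ℝ := fun x => max (-R) (min R x) with hφ
  have hφm : Monotone φ := fun x y h => max_le_max le_rfl (min_le_min le_rfl h)
  have hφb : ∀ x, |φ x| ≤ R := fun x =>
    abs_le.2 ⟨le_max_left _ _, max_le (by linarith) (min_le_left _ _)⟩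
  have hzero : ∀ x, R ≤ |x| → g x = 0 := by
    intro x hx
    by_contra hne
    have := hM (subset_tsupport _ hne)
    rw [mem_closedBall_zero_iff, Real.norm_eq_abs] at this
    linarith [le_abs_self M]
  have hgφ : ∀ x, g (φ x) = g x := by
    intro x
    rcases le_total R x with h | h
    · rw [hzero x (h.trans (le_abs_self _)), hzero]
      simp only [hφ, min_eq_left h, max_eq_right (neg_le_self hR)]
      exact le_abs_self _
    · rcases le_total x (-R) with h' | h'
      · rw [hzero x (by linarith [neg_abs_le x]), hzero]
        simp only [hφ, min_eq_right h, max_eq_left h', abs_neg]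
        exact le_abs_self _
      · simp only [hφ, min_eq_right h, max_eq_right h']
  refine ⟨2 * C / δ * (2 * R), fun n x s hs => ?_⟩
  -- Clamped gaps below `δ` are handled by uniform continuity; a gap of at least `δ` satisfies `2 *
  -- C ≤ 2 * C / δ * gap`.
  have hpt : ∀ a b, |g (x b) - g (x a)| ≤ η + 2 * C / δ * |φ (x b) - φ (x a)| := by
    intro a b
    rw [← hgφ (x b), ← hgφ (x a)]
    rcases lt_or_ge |φ (x b) - φ (x a)| δ with h | h
    · have := huc (a := φ (x b)) (b := φ (x a)) (by rwa [Real.dist_eq])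
      rw [Real.dist_eq] at this
      have : 0 ≤ 2 * C / δ * |φ (x b) - φ (x a)| := by positivity
      linarith
    · have h1 : |g (φ (x b)) - g (φ (x a))| ≤ 2 * C := by
        have h2 := hC (φ (x b))
        have h3 := hC (φ (x a))
        rw [Real.norm_eq_abs] at h2 h3
        linarith [abs_sub (g (φ (x b))) (g (φ (x a)))]
      have h4 : 2 * C / δ * δ ≤ 2 * C / δ * |φ (x b) - φ (x a)| :=
        mul_le_mul_of_nonneg_left h (by positivity)
      rw [div_mul_cancel₀ _ hδ.ne'] at h4
      linarith
  refine (adjacentSum_mono hpt s).trans ?_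
  rw [adjacentSum_add, adjacentSum_const_mul]
  refine add_le_add (adjacentSum_const_le hη.le s) (mul_le_mul_of_nonneg_left ?_ (by positivity))
  exact adjacentSum_abs_sub_le_of_monotone (φ := fun i => φ (x i))
    (fun i j hij => hφm (hs hij)) hR fun i => hφb _

/-! ### Almost sure limits along the sorted sample -/

/-- `(Xs i, Ys i)`, `i : ℕ`, are independent with law `μ`. -/
structure IsIIDSample {Ω : Type*} {mΩ : MeasurableSpace Ω} (P : Measure Ω) (μ : Measure (ℝ × ℝ))
    (Xs Ys : ℕ → Ω → ℝ) : Prop where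
  measurable_xs : ∀ i, Measurable (Xs i)
  measurable_ys : ∀ i, Measurable (Ys i)
  indep : iIndepFun (fun (i : ℕ) (ω : Ω) => (Xs i ω, Ys i ω)) P
  map_eq : ∀ i, P.map (fun ω => (Xs i ω, Ys i ω)) = μ

variable {Ω : Type*} {mΩ : MeasurableSpace Ω} {P : Measure Ω}
  {μ : Measure (ℝ × ℝ)} {Xs Ys : ℕ → Ω → ℝ}

lemma IsIIDSample.ae_tendsto_mean (hZ : IsIIDSample P μ Xs Ys) {f : ℝ × ℝ → ℝ}
    (hf : Measurable f) (hfi : Integrable f μ) :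
    ∀ᵐ ω ∂P, Tendsto (fun n : ℕ => (1 / (n : ℝ)) * ∑ i : Fin n, f (Xs i ω, Ys i ω)) atTop
      (𝓝 (∫ p, f p ∂μ)) := by
  have h1 := hZ.measurable_xs
  have h2 := hZ.measurable_ys
  have hm : ∀ i, AEMeasurable (fun ω => (Xs i ω, Ys i ω)) P := fun i => by fun_prop
  have hid : ∀ i, IdentDistrib (fun ω => f (Xs i ω, Ys i ω)) (fun ω => f (Xs 0 ω, Ys 0 ω)) P P :=
    fun i => IdentDistrib.comp ⟨hm i, hm 0, by rw [hZ.map_eq, hZ.map_eq]⟩ hf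
  have hint : Integrable (fun ω => f (Xs 0 ω, Ys 0 ω)) P := by
    rw [← hZ.map_eq 0] at hfi
    exact hfi.comp_measurable (by fun_prop)
  have := strong_law_ae_real (fun i ω => f (Xs i ω, Ys i ω)) hint
    (fun i j hij => (hZ.indep.indepFun hij).comp hf hf) hid
  have hE : ∫ ω, f (Xs 0 ω, Ys 0 ω) ∂P = ∫ p, f p ∂μ := by
    rw [← hZ.map_eq 0, integral_map (hm 0) hf.aestronglyMeasurable]
  filter_upwards [this] with ω hω
  rw [hE] at hω
  refine hω.congr fun n => ?_
  rw [Fin.sum_univ_eq_sum_range (fun i => f (Xs i ω, Ys i ω)) n, one_div_mul_eq_div]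

variable [IsProbabilityMeasure P]

lemma IsIIDSample.isProbabilityMeasure (hZ : IsIIDSample P μ Xs Ys) : IsProbabilityMeasure μ := by
  have h1 := hZ.measurable_xs 0
  have h2 := hZ.measurable_ys 0
  rw [← hZ.map_eq 0]
  exact Measure.isProbabilityMeasure_map (by fun_prop)

lemma IsIIDSample.map_pi_eq (hZ : IsIIDSample P μ Xs Ys) (n : ℕ) :
    P.map (fun ω (i : Fin n) => (Xs i ω, Ys i ω)) = Measure.pi fun _ => μ := by
  have h1 := hZ.measurable_xs
  have h2 := hZ.measurable_ys
  have := (iIndepFun_iff_map_fun_eq_pi_map (fun i : Fin n => by fun_prop)).1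
    (hZ.indep.precomp (g := fun i : Fin n => i.1) Fin.val_injective)
  rw [this]
  simp_rw [hZ.map_eq]

lemma tendsto_one_div_mul_const (K : ℝ) :
    Tendsto (fun n : ℕ => (1 / (n : ℝ)) * K) atTop (𝓝 0) := by
  simpa using tendsto_one_div_atTop_nhds_zero_nat.mul_const K

/-- A bounded function varies negligibly, on average, along the sorted first coordinates. -/
lemma IsIIDSample.ae_tendsto_variation (hZ : IsIIDSample P μ Xs Ys)
    {s : (n : ℕ) → Ω → Equiv.Perm (Fin n)}
    (hs : ∀ᵐ ω ∂P, ∀ n, s n ω ∈ sortingPerms fun i : Fin n => Xs i ω)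
    {f : ℝ → ℝ} (hf : Measurable f) {C : ℝ} (hC : ∀ x, |f x| ≤ C) :
    ∀ᵐ ω ∂P, Tendsto (fun n : ℕ => (1 / (n : ℝ)) *
      adjacentSum (fun a b : Fin n => |f (Xs b ω) - f (Xs a ω)|) (s n ω)) atTop (𝓝 0) := by
  have := hZ.isProbabilityMeasure
  have : IsProbabilityMeasure (μ.map Prod.fst) :=
    Measure.isProbabilityMeasure_map measurable_fst.aemeasurable
  -- The constant 6: the mean of `|f - g|` is eventually below `2 * ε` and enters once for each
  -- neighbour, the variation of `g` adds `ε`, and `K / n` adds less than `ε`.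
  have key : ∀ k : ℕ, ∀ᵐ ω ∂P, ∀ᶠ n : ℕ in atTop, (1 / (n : ℝ)) *
      adjacentSum (fun a b : Fin n => |f (Xs b ω) - f (Xs a ω)|) (s n ω) < 6 * (1 / (k + 1)) := by
    intro k
    set ε : ℝ := 1 / (k + 1)
    have hε : 0 < ε := by positivity
    obtain ⟨g, hgs, hfg, hg, hgi⟩ := (integrable_of_abs_le (μ := μ.map Prod.fst) hf
      hC).exists_hasCompactSupport_integral_sub_le hε
    obtain ⟨K, hK⟩ := exists_adjacentSum_abs_sub_le hg hgs hε
    have hgm := hg.measurable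
    have hfgi : Integrable (fun x => |f x - g x|) (μ.map Prod.fst) :=
      ((integrable_of_abs_le hf hC).sub hgi).abs
    rw [integral_map measurable_fst.aemeasurable
      (Measurable.aestronglyMeasurable (by fun_prop))] at hfg
    have hlln := hZ.ae_tendsto_mean (f := fun p => |f p.1 - g p.1|) (by fun_prop)
      (hfgi.comp_measurable measurable_fst)
    filter_upwards [hs, hlln] with ω hsω hω
    have h1 := hω.eventually (gt_mem_nhds (hfg.trans_lt (lt_add_of_pos_right ε hε)))
    have h2 := (tendsto_one_div_mul_const K).eventually (gt_mem_nhds hε)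
    filter_upwards [h1, h2, eventually_gt_atTop 0] with n hn1 hn2 hn0
    have hn0' : (0 : ℝ) < n := by exact_mod_cast hn0
    have hb : adjacentSum (fun a b : Fin n => |f (Xs b ω) - f (Xs a ω)|) (s n ω) ≤
        ∑ i : Fin n, |f (Xs i ω) - g (Xs i ω)| + ∑ i : Fin n, |f (Xs i ω) - g (Xs i ω)| +
          (n * ε + K) := by
      refine (adjacentSum_mono (r := fun a b : Fin n => |f (Xs a ω) - g (Xs a ω)| +
        |f (Xs b ω) - g (Xs b ω)| + |g (Xs b ω) - g (Xs a ω)|) (fun a b => ?_) _).trans ?_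
      · have e : f (Xs b ω) - f (Xs a ω) = -(f (Xs a ω) - g (Xs a ω)) +
          (f (Xs b ω) - g (Xs b ω)) + (g (Xs b ω) - g (Xs a ω)) := by ring
        rw [e]
        exact (abs_add_three _ _ _).trans (by rw [abs_neg])
      · rw [adjacentSum_add, adjacentSum_add (fun a _ => _) (fun _ b => _)]
        exact add_le_add (add_le_add (adjacentSum_left_le (fun _ => abs_nonneg _) _)
          (adjacentSum_right_le (fun _ => abs_nonneg _) _)) (hK n _ _ (hsω n))
    calc _ ≤ (1 / (n : ℝ)) * (∑ i : Fin n, |f (Xs i ω) - g (Xs i ω)| +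
          ∑ i : Fin n, |f (Xs i ω) - g (Xs i ω)| + (n * ε + K)) :=
          mul_le_mul_of_nonneg_left hb (by positivity)
      _ = 2 * ((1 / (n : ℝ)) * ∑ i : Fin n, |f (Xs i ω) - g (Xs i ω)|) + ε +
          (1 / (n : ℝ)) * K := by field_simp; ring
      _ < 6 * ε := by linarith
  filter_upwards [ae_all_iff.2 key] with ω hω
  rw [tendsto_order]
  refine ⟨fun a ha => Eventually.of_forall fun n => ha.trans_le ?_, fun a ha => ?_⟩
  · exact mul_nonneg (by positivity) (Finset.sum_nonneg fun _ _ => abs_nonneg _)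
  · obtain ⟨k, hk⟩ := exists_nat_one_div_lt (show 0 < a / 6 by positivity)
    filter_upwards [hω k] with n hn
    linarith

/-- Replacing `f (X_a)` by `f (X_b)` costs at most `D` times the variation of `f`, which is
negligible. What remains is an ordinary mean up to one boundary term. -/
lemma IsIIDSample.ae_tendsto_adjacent_of_fst_left (hZ : IsIIDSample P μ Xs Ys)
    {s : (n : ℕ) → Ω → Equiv.Perm (Fin n)}
    (hs : ∀ᵐ ω ∂P, ∀ n, s n ω ∈ sortingPerms fun i : Fin n => Xs i ω)
    {f : ℝ → ℝ} (hf : Measurable f) {C : ℝ} (hC : ∀ x, |f x| ≤ C)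
    {g : ℝ × ℝ → ℝ} (hg : Measurable g) {D : ℝ} (hD : ∀ p, |g p| ≤ D) :
    ∀ᵐ ω ∂P, Tendsto (fun n : ℕ => (1 / (n : ℝ)) *
      adjacentSum (fun a b : Fin n => f (Xs a ω) * g (Xs b ω, Ys b ω)) (s n ω)) atTop
      (𝓝 (∫ p, f p.1 * g p ∂μ)) := by
  have := hZ.isProbabilityMeasure
  have hC0 : 0 ≤ C := (abs_nonneg _).trans (hC 0)
  have hD0 : 0 ≤ D := (abs_nonneg _).trans (hD 0)
  have hb : ∀ p : ℝ × ℝ, |f p.1 * g p| ≤ C * D := fun p => by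
    rw [abs_mul]; exact mul_le_mul (hC _) (hD _) (abs_nonneg _) hC0
  filter_upwards [hZ.ae_tendsto_variation hs hf hC,
    hZ.ae_tendsto_mean (f := fun p => f p.1 * g p) (by fun_prop)
      (integrable_of_abs_le (by fun_prop) hb)] with ω h1 h2
  have hlim := (h1.mul_const D).add (tendsto_one_div_mul_const (C * D))
  rw [zero_mul, add_zero] at hlim
  refine h2.congr_dist (squeeze_zero (fun _ => dist_nonneg) (fun n => ?_) hlim)
  rw [Real.dist_eq, abs_sub_comm, ← mul_sub, abs_mul,
    abs_of_nonneg (one_div_nonneg.2 n.cast_nonneg), mul_assoc, ← mul_add]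
  refine mul_le_mul_of_nonneg_left ?_ (by positivity)
  have h3 := abs_adjacentSum_right_sub_le (u := fun i : Fin n => f (Xs i ω) * g (Xs i ω, Ys i ω))
    (C := C * D) (by positivity) (fun i => hb (Xs i ω, Ys i ω)) (s n ω)
  have h4 : |adjacentSum (fun a b : Fin n => f (Xs a ω) * g (Xs b ω, Ys b ω)) (s n ω) -
      adjacentSum (fun _ b : Fin n => f (Xs b ω) * g (Xs b ω, Ys b ω)) (s n ω)| ≤
      adjacentSum (fun a b : Fin n => |f (Xs b ω) - f (Xs a ω)|) (s n ω) * D := by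
    rw [← adjacentSum_sub, mul_comm, ← adjacentSum_const_mul]
    refine (abs_adjacentSum_le _ _).trans (adjacentSum_mono (fun a b => ?_) _)
    rw [← sub_mul, abs_mul, abs_sub_comm, mul_comm]
    exact mul_le_mul_of_nonneg_right (hD _) (abs_nonneg _)
  exact (abs_sub_le _ _ _).trans (add_le_add h4 h3)

lemma IsIIDSample.ae_tendsto_adjacent_of_fst_right (hZ : IsIIDSample P μ Xs Ys)
    {s : (n : ℕ) → Ω → Equiv.Perm (Fin n)}
    (hs : ∀ᵐ ω ∂P, ∀ n, s n ω ∈ sortingPerms fun i : Fin n => Xs i ω)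
    {f : ℝ → ℝ} (hf : Measurable f) {C : ℝ} (hC : ∀ x, |f x| ≤ C)
    {g : ℝ × ℝ → ℝ} (hg : Measurable g) {D : ℝ} (hD : ∀ p, |g p| ≤ D) :
    ∀ᵐ ω ∂P, Tendsto (fun n : ℕ => (1 / (n : ℝ)) *
      adjacentSum (fun a b : Fin n => g (Xs a ω, Ys a ω) * f (Xs b ω)) (s n ω)) atTop
      (𝓝 (∫ p, f p.1 * g p ∂μ)) := by
  have := hZ.isProbabilityMeasure
  have hC0 : 0 ≤ C := (abs_nonneg _).trans (hC 0)
  have hD0 : 0 ≤ D := (abs_nonneg _).trans (hD 0)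
  have hb : ∀ p : ℝ × ℝ, |f p.1 * g p| ≤ C * D := fun p => by
    rw [abs_mul]; exact mul_le_mul (hC _) (hD _) (abs_nonneg _) hC0
  filter_upwards [hZ.ae_tendsto_variation hs hf hC,
    hZ.ae_tendsto_mean (f := fun p => f p.1 * g p) (by fun_prop)
      (integrable_of_abs_le (by fun_prop) hb)] with ω h1 h2
  have hlim := (h1.mul_const D).add (tendsto_one_div_mul_const (C * D))
  rw [zero_mul, add_zero] at hlim
  refine h2.congr_dist (squeeze_zero (fun _ => dist_nonneg) (fun n => ?_) hlim)
  rw [Real.dist_eq, abs_sub_comm, ← mul_sub, abs_mul,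
    abs_of_nonneg (one_div_nonneg.2 n.cast_nonneg), mul_assoc, ← mul_add]
  refine mul_le_mul_of_nonneg_left ?_ (by positivity)
  have h3 := abs_adjacentSum_left_sub_le (u := fun i : Fin n => f (Xs i ω) * g (Xs i ω, Ys i ω))
    (C := C * D) (by positivity) (fun i => hb (Xs i ω, Ys i ω)) (s n ω)
  have h4 : |adjacentSum (fun a b : Fin n => g (Xs a ω, Ys a ω) * f (Xs b ω)) (s n ω) -
      adjacentSum (fun a _ : Fin n => f (Xs a ω) * g (Xs a ω, Ys a ω)) (s n ω)| ≤
      adjacentSum (fun a b : Fin n => |f (Xs b ω) - f (Xs a ω)|) (s n ω) * D := by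
    rw [← adjacentSum_sub, mul_comm, ← adjacentSum_const_mul]
    refine (abs_adjacentSum_le _ _).trans (adjacentSum_mono (fun a b => ?_) _)
    rw [mul_comm (g _), ← sub_mul, abs_mul, mul_comm]
    exact mul_le_mul_of_nonneg_right (hD _) (abs_nonneg _)
  exact (abs_sub_le _ _ _).trans (add_le_add h4 h3)

/-- Borel–Cantelli with the geometric tail bound. No relation between the orderings for different
`n` is needed. -/
lemma IsIIDSample.ae_eventually_adjacentSum_lt (hZ : IsIIDSample P μ Xs Ys)
    {s : (n : ℕ) → Ω → Equiv.Perm (Fin n)}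
    (hs : ∀ n, IsRandomSorting P (fun i : Fin n => Xs i) (fun i : Fin n => Ys i) (s n))
    {e d : ℝ × ℝ → ℝ} (he : Measurable e) (hd : Measurable d) (heb : ∀ p, |e p| ≤ 1)
    (hdb : ∀ p, |d p| ≤ 1) (hc : FstCentered μ d) {η : ℝ} (hη : 0 < η) :
    ∀ᵐ ω ∂P, ∀ᶠ n : ℕ in atTop, adjacentSum
      (fun a b : Fin n => e (Xs a ω, Ys a ω) * d (Xs b ω, Ys b ω)) (s n ω) < n * η := by
  have := hZ.isProbabilityMeasure
  have htail := fun n => (hs n).measureReal_adjacentSum_ge_le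
    (fun i => hZ.measurable_xs i) (fun i => hZ.measurable_ys i) (hZ.map_pi_eq n) he hd heb hdb
    hc hη
  have hsum : Summable fun n : ℕ => Real.exp (-(η ^ 2 / 2)) ^ n :=
    summable_geometric_of_lt_one (Real.exp_pos _).le (Real.exp_lt_one_iff.2 (by
      have : 0 < η ^ 2 / 2 := by positivity
      linarith))
  have hsum' := (Summable.of_nonneg_of_le (fun _ => measureReal_nonneg) htail hsum).tsum_ofReal_ne_top
  simp_rw [fun n => ofReal_measureReal (μ := P) (h := measure_ne_top _ _)] at hsum'
  filter_upwards [ae_eventually_notMem hsum'] with ω hω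
  filter_upwards [hω] with n hn
  simpa using hn

lemma IsIIDSample.ae_tendsto_adjacent_of_centered (hZ : IsIIDSample P μ Xs Ys)
    {s : (n : ℕ) → Ω → Equiv.Perm (Fin n)}
    (hs : ∀ n, IsRandomSorting P (fun i : Fin n => Xs i) (fun i : Fin n => Ys i) (s n))
    {e d : ℝ × ℝ → ℝ} (he : Measurable e) (hd : Measurable d) {C : ℝ} (hC : 0 < C)
    (heb : ∀ p, |e p| ≤ C) (hdb : ∀ p, |d p| ≤ C) (hc : FstCentered μ d) :
    ∀ᵐ ω ∂P, Tendsto (fun n : ℕ => (1 / (n : ℝ)) * adjacentSum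
      (fun a b : Fin n => e (Xs a ω, Ys a ω) * d (Xs b ω, Ys b ω)) (s n ω)) atTop (𝓝 0) := by
  have hnorm : ∀ {f : ℝ × ℝ → ℝ}, (∀ p, |f p| ≤ C) → ∀ p, |f p / C| ≤ 1 := fun hf p => by
    rw [abs_div, abs_of_pos hC]; exact div_le_one_of_le₀ (hf p) hC.le
  have hc' : FstCentered μ fun p => d p / C := fun H hH hb => by
    simp_rw [← mul_div_assoc, integral_div, hc H hH hb, zero_div]
  have h1 : ∀ k : ℕ, _ := fun k => hZ.ae_eventually_adjacentSum_lt hs (he.div_const C)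
    (hd.div_const C) (hnorm heb) (hnorm hdb) hc' (η := 1 / (k + 1)) (by positivity)
  -- Negating `e` rather than `d` gives the lower tail with the same centredness hypothesis.
  have h2 : ∀ k : ℕ, _ := fun k => hZ.ae_eventually_adjacentSum_lt hs (he.neg.div_const C)
    (hd.div_const C) (hnorm fun p => by simpa using heb p) (hnorm hdb) hc' (η := 1 / (k + 1))
    (by positivity)
  filter_upwards [ae_all_iff.2 h1, ae_all_iff.2 h2] with ω hω1 hω2
  rw [Metric.tendsto_atTop']
  intro ε hε
  obtain ⟨k, hk⟩ := exists_nat_one_div_lt (show 0 < ε / C ^ 2 by positivity)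
  obtain ⟨N, hN⟩ := eventually_atTop.1
    ((hω1 k).and ((hω2 k).and (eventually_gt_atTop 0)))
  refine ⟨N, fun n hn => ?_⟩
  obtain ⟨h3, h4, hn0⟩ := hN n hn.le
  have hn0' : (0 : ℝ) < n := by exact_mod_cast hn0
  set S := adjacentSum (fun a b : Fin n => e (Xs a ω, Ys a ω) * d (Xs b ω, Ys b ω)) (s n ω)
  have h5 : adjacentSum (fun a b : Fin n => e (Xs a ω, Ys a ω) / C * (d (Xs b ω, Ys b ω) / C))
      (s n ω) = 1 / C ^ 2 * S := by
    rw [← adjacentSum_const_mul]; congr 1; funext a b; field_simp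
  have h6 : adjacentSum (fun a b : Fin n => (-e) (Xs a ω, Ys a ω) / C * (d (Xs b ω, Ys b ω) / C))
      (s n ω) = -(1 / C ^ 2) * S := by
    rw [← adjacentSum_const_mul]; congr 1; funext a b; simp only [Pi.neg_apply]; field_simp
  rw [h5] at h3
  rw [h6] at h4
  have h7 : |S| < n * ε := by
    have h8 : |1 / C ^ 2 * S| < n * (ε / C ^ 2) :=
      (abs_lt.2 ⟨by linarith, h3⟩).trans (mul_lt_mul_of_pos_left hk hn0')
    rw [abs_mul, abs_of_pos (by positivity)] at h8
    field_simp at h8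
    linarith
  rw [Real.dist_eq, sub_zero, abs_mul, abs_of_pos (by positivity), one_div_mul_eq_div,
    div_lt_iff₀ hn0']
  linarith

end RankCorr

/-! ### Products, and approximation of `h` by products -/

namespace RankCorr

lemma abs_integral_le_of_abs_le {α : Type*} [MeasurableSpace α] {m : Measure α}
    [IsProbabilityMeasure m] {f : α → ℝ} {C : ℝ} (hC : ∀ x, |f x| ≤ C) : |∫ x, f x ∂m| ≤ C := by
  simpa using norm_integral_le_of_norm_le_const (μ := m) (f := f) (ae_of_all _ hC)

lemma fstCentered_sub_integral {ν : Measure ℝ} [IsProbabilityMeasure ν] {κ : Kernel ℝ ℝ}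
    [IsMarkovKernel κ] {ψ : ℝ → ℝ} (hψ : Measurable ψ) {C : ℝ} (hC : ∀ y, |ψ y| ≤ C) :
    FstCentered (ν ⊗ₘ κ) fun p => ψ p.2 - ∫ y, ψ y ∂(κ p.1) := by
  intro H hH ⟨D, hD⟩
  have hm : Measurable fun x => ∫ y, ψ y ∂(κ x) :=
    (hψ.stronglyMeasurable.integral_kernel (κ := κ)).measurable
  have hD0 : 0 ≤ D := (abs_nonneg _).trans (hD 0)
  have hb : ∀ p : ℝ × ℝ, |H p.1 * (ψ p.2 - ∫ y, ψ y ∂(κ p.1))| ≤ D * (C + C) := fun p => by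
    rw [abs_mul]
    exact mul_le_mul (hD _) ((abs_sub _ _).trans (add_le_add (hC _) (abs_integral_le_of_abs_le hC)))
      (abs_nonneg _) hD0
  have hmeas : Measurable fun p : ℝ × ℝ => H p.1 * (ψ p.2 - ∫ y, ψ y ∂(κ p.1)) :=
    (hH.comp measurable_fst).mul ((hψ.comp measurable_snd).sub (hm.comp measurable_fst))
  rw [Measure.integral_compProd (integrable_of_abs_le hmeas hb)]
  refine integral_eq_zero_of_ae (ae_of_all _ fun x => ?_)
  simp only [Pi.zero_apply]
  rw [integral_const_mul, integral_sub (integrable_of_abs_le hψ hC) (integrable_const _)]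
  simp

variable {Ω : Type*} {mΩ : MeasurableSpace Ω} {P : Measure Ω} [IsProbabilityMeasure P]
  {Xs Ys : ℕ → Ω → ℝ}

lemma IsIIDSample.ae_mem_sortingPerms {μ : Measure (ℝ × ℝ)} (hZ : IsIIDSample P μ Xs Ys)
    {s : (n : ℕ) → Ω → Equiv.Perm (Fin n)}
    (hs : ∀ n, IsRandomSorting P (fun i : Fin n => Xs i) (fun i : Fin n => Ys i) (s n)) :
    ∀ᵐ ω ∂P, ∀ n, s n ω ∈ sortingPerms fun i : Fin n => Xs i ω :=
  ae_all_iff.2 fun n => (hs n).ae_mem_sortingPerms (fun i => hZ.measurable_xs i)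
    fun i => hZ.measurable_ys i

/-- The expansion into `A (X_a) ψ (Y_b)`, `(φ - A)_a B (X_b)` and `(φ - A)_a (ψ - B)_b`: only the
first has a nonzero limit, by disintegration equal to `∫ A B`. -/
lemma IsIIDSample.ae_tendsto_adjacent_mul {ν : Measure ℝ} [IsProbabilityMeasure ν]
    {κ : Kernel ℝ ℝ} [IsMarkovKernel κ] (hZ : IsIIDSample P (ν ⊗ₘ κ) Xs Ys)
    {s : (n : ℕ) → Ω → Equiv.Perm (Fin n)}
    (hs : ∀ n, IsRandomSorting P (fun i : Fin n => Xs i) (fun i : Fin n => Ys i) (s n))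
    {φ ψ : ℝ → ℝ} (hφ : Measurable φ) (hψ : Measurable ψ) {C : ℝ} (hφC : ∀ y, |φ y| ≤ C)
    (hψC : ∀ y, |ψ y| ≤ C) :
    ∀ᵐ ω ∂P, Tendsto (fun n : ℕ => (1 / (n : ℝ)) *
      adjacentSum (fun a b : Fin n => φ (Ys a ω) * ψ (Ys b ω)) (s n ω)) atTop
      (𝓝 (∫ x, (∫ y, φ y ∂(κ x)) * (∫ y, ψ y ∂(κ x)) ∂ν)) := by
  set A : ℝ → ℝ := fun x => ∫ y, φ y ∂(κ x) with hA
  set B : ℝ → ℝ := fun x => ∫ y, ψ y ∂(κ x) with hB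
  have hAm : Measurable A := (hφ.stronglyMeasurable.integral_kernel (κ := κ)).measurable
  have hBm : Measurable B := (hψ.stronglyMeasurable.integral_kernel (κ := κ)).measurable
  have hAC : ∀ x, |A x| ≤ C := fun x => abs_integral_le_of_abs_le hφC
  have hBC : ∀ x, |B x| ≤ C := fun x => abs_integral_le_of_abs_le hψC
  have hC0 : 0 ≤ C := (abs_nonneg _).trans (hφC 0)
  have hcA : FstCentered (ν ⊗ₘ κ) fun p => φ p.2 - A p.1 := fstCentered_sub_integral hφ hφC
  have hcB : FstCentered (ν ⊗ₘ κ) fun p => ψ p.2 - B p.1 := fstCentered_sub_integral hψ hψC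
  have hεb : ∀ p : ℝ × ℝ, |φ p.2 - A p.1| ≤ 2 * C + 1 := fun p => by
    linarith [abs_sub (φ p.2) (A p.1), hφC p.2, hAC p.1]
  have hδb : ∀ p : ℝ × ℝ, |ψ p.2 - B p.1| ≤ 2 * C + 1 := fun p => by
    linarith [abs_sub (ψ p.2) (B p.1), hψC p.2, hBC p.1]
  have hsort := hZ.ae_mem_sortingPerms hs
  have hlim1 : ∫ p, A p.1 * ψ p.2 ∂(ν ⊗ₘ κ) = ∫ x, A x * B x ∂ν := by
    rw [Measure.integral_compProd (integrable_of_abs_le (C := C * C) (by fun_prop) fun p => by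
      rw [abs_mul]; exact mul_le_mul (hAC _) (hψC _) (abs_nonneg _) hC0)]
    simp_rw [integral_const_mul, hB]
  filter_upwards [hZ.ae_tendsto_adjacent_of_fst_left hsort hAm hAC (g := fun p => ψ p.2)
      (by fun_prop) (fun p => hψC p.2),
    hZ.ae_tendsto_adjacent_of_fst_right hsort hBm hBC (g := fun p => φ p.2 - A p.1)
      (by fun_prop) hεb,
    -- The bound `2 * C + 1` rather than `2 * C` keeps the scaling constant positive when `C = 0`.
    hZ.ae_tendsto_adjacent_of_centered hs (e := fun p => φ p.2 - A p.1)
      (d := fun p => ψ p.2 - B p.1) (by fun_prop) (by fun_prop) (C := 2 * C + 1) (by linarith)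
      hεb hδb hcB] with ω h1 h2 h3
  rw [hlim1] at h1
  rw [hcA B hBm ⟨C, hBC⟩] at h2
  have := (h1.add h2).add h3
  rw [add_zero, add_zero] at this
  refine this.congr fun n => ?_
  rw [← mul_add, ← mul_add, ← adjacentSum_add, ← adjacentSum_add]
  congr 2
  funext a b
  ring

/-- A function that is `K`-Lipschitz in its first argument is within `K / N` of a sum of `N + 1`
products of functions of one variable. -/
lemma abs_sub_sum_floor_le {h : ℝ → ℝ → ℝ} {K : ℝ}
    (hK : ∀ u ∈ Icc (0 : ℝ) 1, ∀ u' ∈ Icc (0 : ℝ) 1, ∀ v ∈ Icc (0 : ℝ) 1,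
      |h u v - h u' v| ≤ K * |u - u'|)
    (hK0 : 0 ≤ K) {N : ℕ} (hN : 0 < N) {u v : ℝ} (hu : u ∈ Icc (0 : ℝ) 1)
    (hv : v ∈ Icc (0 : ℝ) 1) :
    |h u v - ∑ k ∈ Finset.range (N + 1), (if ⌊(N : ℝ) * u⌋₊ = k then 1 else 0) * h (k / N) v| ≤
      K * (1 / N) := by
  have hN' : (0 : ℝ) < N := by exact_mod_cast hN
  have hNu : 0 ≤ (N : ℝ) * u := mul_nonneg hN'.le hu.1
  have hfl : ⌊(N : ℝ) * u⌋₊ ≤ N := Nat.floor_le_of_le (mul_le_of_le_one_right hN'.le hu.2)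
  -- The indicators select the single term `k = ⌊N u⌋`; the value `k = N` occurs at `u = 1`, hence
  -- `N + 1` terms.
  simp only [ite_mul, one_mul, zero_mul, Finset.sum_ite_eq, Finset.mem_range,
    Nat.lt_succ_of_le hfl, if_true]
  have h1 := Nat.floor_le hNu
  have h2 := Nat.lt_floor_add_one ((N : ℝ) * u)
  refine (hK u hu _ ⟨by positivity, ?_⟩ v hv).trans (mul_le_mul_of_nonneg_left ?_ hK0)
  · rw [div_le_one hN']; exact_mod_cast hfl
  · rw [abs_of_nonneg (by rw [sub_nonneg, div_le_iff₀ hN']; linarith), sub_le_iff_le_add,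
      ← add_div, le_div_iff₀ hN']
    linarith

lemma measurable_ite_floor_eq {α : Type*} [MeasurableSpace α] {f : α → ℝ} (hf : Measurable f)
    (N : ℝ) (k : ℕ) : Measurable fun x => if ⌊N * f x⌋₊ = k then (1 : ℝ) else 0 :=
  Measurable.ite ((measurableSet_singleton k).preimage (f := fun x => ⌊N * f x⌋₊)
    (Nat.measurable_floor.comp (by fun_prop))) measurable_const measurable_const

lemma div_mem_Icc_of_le {N k : ℕ} (hk : k ≤ N) : (k / N : ℝ) ∈ Icc (0 : ℝ) 1 :=
  ⟨by positivity, div_le_one_of_le₀ (by exact_mod_cast hk) (by positivity)⟩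

/-- Taking `C ≥ 1` lets one constant bound `h` and the indicators of the approximation alike. -/
lemma RegularityCondition.exists_abs_le {h : ℝ → ℝ → ℝ} (hreg : RegularityCondition h) :
    ∃ C, 1 ≤ C ∧ ∀ u ∈ Icc (0 : ℝ) 1, ∀ v ∈ Icc (0 : ℝ) 1, |h u v| ≤ C := by
  obtain ⟨C, hC⟩ := (isCompact_Icc.prod isCompact_Icc).exists_bound_of_continuousOn
    hreg.continuousOn
  exact ⟨max 1 C, le_max_left _ _, fun u hu v hv => (hC (u, v) ⟨hu, hv⟩).trans (le_max_right _ _)⟩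

lemma measurable_comp_of_continuousOn {g : ℝ × ℝ → ℝ}
    (hg : ContinuousOn g (Icc (0 : ℝ) 1 ×ˢ Icc (0 : ℝ) 1)) {α : Type*} [MeasurableSpace α]
    {f : α → ℝ × ℝ} (hf : Measurable f) (hf1 : ∀ x, f x ∈ Icc (0 : ℝ) 1 ×ˢ Icc (0 : ℝ) 1) :
    Measurable fun x => g (f x) :=
  (continuousOn_iff_continuous_domRestrict.1 hg).measurable.comp (hf.subtype_mk (h := hf1))

/-- Convergence of averaging functionals on products of functions of one variable implies
convergence on Lipschitz functions of two variables. -/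
lemma tendsto_of_tendsto_mul {h : ℝ → ℝ → ℝ} (hreg : RegularityCondition h)
    (hlip : LipschitzCondition h) {F : ℝ → ℝ} (hFm : Measurable F)
    (hF : ∀ y, F y ∈ Icc (0 : ℝ) 1) {A : ℕ → (ℝ → ℝ → ℝ) → ℝ} {L : Measure (ℝ × ℝ)}
    [IsProbabilityMeasure L]
    (hsum : ∀ (n N : ℕ) (q : ℕ → ℝ → ℝ → ℝ), A n (fun y z => ∑ k ∈ Finset.range N, q k y z) =
      ∑ k ∈ Finset.range N, A n (q k))
    (hsub : ∀ (n : ℕ) (q r : ℝ → ℝ → ℝ) (C : ℝ), (∀ y z, |q y z - r y z| ≤ C) →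
      |A n q - A n r| ≤ C)
    (hlim : ∀ N k : ℕ, k ≤ N → Tendsto (fun n => A n fun y z =>
      (if ⌊(N : ℝ) * F y⌋₊ = k then 1 else 0) * h (k / N) (F z)) atTop
      (𝓝 (∫ p, (if ⌊(N : ℝ) * F p.1⌋₊ = k then 1 else 0) * h (k / N) (F p.2) ∂L))) :
    Tendsto (fun n => A n fun y z => h (F y) (F z)) atTop (𝓝 (∫ p, h (F p.1) (F p.2) ∂L)) := by
  obtain ⟨K, hK0, hK⟩ := hlip
  have hK' : ∀ u ∈ Icc (0 : ℝ) 1, ∀ u' ∈ Icc (0 : ℝ) 1, ∀ v ∈ Icc (0 : ℝ) 1,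
      |h u v - h u' v| ≤ K * |u - u'| := fun u hu u' hu' v hv => by
    simpa using hK u hu v hv u' hu' v hv
  obtain ⟨C, hC1, hb⟩ := hreg.exists_abs_le
  rw [Metric.tendsto_atTop']
  intro ε hε
  -- Three errors below `ε / 3`: approximation inside `A n`, approximation inside the limit
  -- integral, and convergence of the finite sum.
  obtain ⟨m, hm⟩ := exists_nat_one_div_lt (show 0 < ε / (3 * K) by positivity)
  set N := m + 1 with hN
  have hN0 : 0 < N := m.succ_pos
  have hN0' : (0 : ℝ) < N := by exact_mod_cast hN0
  have hKN : K * (1 / N) < ε / 3 := by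
    have := mul_lt_mul_of_pos_left hm hK0
    rw [hN]; push_cast
    refine this.trans_eq ?_
    field_simp
  set q : ℕ → ℝ → ℝ → ℝ := fun k y z =>
    (if ⌊(N : ℝ) * F y⌋₊ = k then 1 else 0) * h (k / N) (F z) with hq
  have happrox : ∀ y z, |h (F y) (F z) - ∑ k ∈ Finset.range (N + 1), q k y z| ≤ K * (1 / N) :=
    fun y z => abs_sub_sum_floor_le hK' hK0.le hN0 (hF y) (hF z)
  have hmem : ∀ k ∈ Finset.range (N + 1), (k / N : ℝ) ∈ Icc (0 : ℝ) 1 := fun k hk =>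
    div_mem_Icc_of_le (Nat.lt_succ_iff.1 (Finset.mem_range.1 hk))
  have hqi : ∀ k ∈ Finset.range (N + 1), Integrable (fun p : ℝ × ℝ => q k p.1 p.2) L := by
    intro k hk
    refine integrable_of_abs_le (C := C) ?_ fun p => ?_
    · exact (measurable_ite_floor_eq (by fun_prop) _ _).mul
        (measurable_comp_of_continuousOn hreg.continuousOn
          (f := fun p : ℝ × ℝ => ((k / N : ℝ), F p.2)) (by fun_prop)
          fun p => ⟨hmem k hk, hF p.2⟩)
    · have := hb _ (hmem k hk) _ (hF p.2)
      simp only [hq]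
      split_ifs <;> simp [this, zero_le_one.trans hC1]
  have hhi : Integrable (fun p : ℝ × ℝ => h (F p.1) (F p.2)) L :=
    integrable_of_abs_le (measurable_comp_of_continuousOn hreg.continuousOn
      (f := fun p : ℝ × ℝ => (F p.1, F p.2)) (by fun_prop) fun p => ⟨hF _, hF _⟩)
      fun p => hb _ (hF _) _ (hF _)
  have hI : |∫ p, h (F p.1) (F p.2) ∂L - ∑ k ∈ Finset.range (N + 1), ∫ p, q k p.1 p.2 ∂L| ≤
      K * (1 / N) := by
    rw [← integral_finsetSum _ hqi, ← integral_sub hhi (integrable_finsetSum _ hqi)]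
    exact abs_integral_le_of_abs_le fun p => happrox _ _
  have hT : Tendsto (fun n => ∑ k ∈ Finset.range (N + 1), A n (q k)) atTop
      (𝓝 (∑ k ∈ Finset.range (N + 1), ∫ p, q k p.1 p.2 ∂L)) :=
    tendsto_finsetSum _ fun k hk => hlim N k (Nat.lt_succ_iff.1 (Finset.mem_range.1 hk))
  obtain ⟨M, hM⟩ := (Metric.tendsto_atTop'.1 hT) (ε / 3) (by positivity)
  refine ⟨M, fun n hn => ?_⟩
  have h1 := hM n hn
  have h2 := hsub n _ _ _ happrox
  rw [hsum] at h2
  rw [Real.dist_eq] at h1 ⊢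
  rw [abs_le] at h2 hI
  rw [abs_lt] at h1 ⊢
  constructor <;> linarith [h2.1, h2.2, hI.1, hI.2, h1.1, h1.2]

end RankCorr

/-! ### Glivenko–Cantelli by level sets -/

namespace RankCorr

/-- Inner regularity. Compact sets are convenient below because they have greatest and least
elements. -/
lemma measureReal_le_of_forall_isCompact {m : Measure ℝ} [IsProbabilityMeasure m] {S : Set ℝ}
    (hS : MeasurableSet S) {u : ℝ} (hu : 0 ≤ u)
    (h : ∀ T ⊆ S, IsCompact T → T.Nonempty → m.real T ≤ u) : m.real S ≤ u := by
  by_contra! hlt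
  obtain ⟨T, hTS, hT, hlt'⟩ := hS.exists_lt_isCompact (μ := m) (r := ENNReal.ofReal u)
    ((ENNReal.ofReal_lt_iff_lt_toReal hu (measure_ne_top _ _)).2 hlt)
  have hlt'' := (ENNReal.ofReal_lt_iff_lt_toReal hu (measure_ne_top _ _)).1 hlt'
  rcases T.eq_empty_or_nonempty with rfl | hne
  · simp at hlt''; linarith
  · exact (h T hTS hT hne).not_gt hlt''

lemma measurable_measureReal_Iic (m : Measure ℝ) [IsProbabilityMeasure m] :
    Measurable fun y => m.real (Iic y) :=
  Monotone.measurable fun _ _ hab => measureReal_mono (Iic_subset_Iic.2 hab)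

lemma measurable_measureReal_Ici (m : Measure ℝ) [IsProbabilityMeasure m] :
    Measurable fun y => m.real (Ici y) :=
  Antitone.measurable fun _ _ hab => measureReal_mono (Ici_subset_Ici.2 hab)

/-- A compact subset of the level set lies in `Iic x` for its greatest element `x`, and `Iic x` has
mass below `u`. Atoms need no separate treatment. -/
lemma measureReal_setOf_measureReal_Iic_lt_le (m : Measure ℝ) [IsProbabilityMeasure m] {u : ℝ}
    (hu : 0 ≤ u) : m.real {y | m.real (Iic y) < u} ≤ u := by
  refine measureReal_le_of_forall_isCompact
    (measurableSet_lt (measurable_measureReal_Iic m) measurable_const) hu fun T hTS hT hne => ?_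
  obtain ⟨x, hxT, hx⟩ := hT.exists_isGreatest hne
  exact (measureReal_mono fun y hy => hx hy).trans (hTS hxT).le

lemma measureReal_setOf_measureReal_Ici_lt_le (m : Measure ℝ) [IsProbabilityMeasure m] {u : ℝ}
    (hu : 0 ≤ u) : m.real {y | m.real (Ici y) < u} ≤ u := by
  refine measureReal_le_of_forall_isCompact
    (measurableSet_lt (measurable_measureReal_Ici m) measurable_const) hu fun T hTS hT hne => ?_
  obtain ⟨x, hxT, hx⟩ := hT.exists_isLeast hne
  exact (measureReal_mono fun y hy => hx hy).trans (hTS hxT).le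

/-- The proportion of the sample `y` that lies in `S`. -/
noncomputable def frequency {n : ℕ} (y : Fin n → ℝ) (S : Set ℝ) : ℝ :=
  (1 / (n : ℝ)) * ∑ i, S.indicator (fun _ => (1 : ℝ)) (y i)

lemma frequency_mono {n : ℕ} (y : Fin n → ℝ) {S T : Set ℝ} (h : S ⊆ T) :
    frequency y S ≤ frequency y T :=
  mul_le_mul_of_nonneg_left (Finset.sum_le_sum fun _ _ =>
    indicator_le_indicator_of_subset h (fun _ => zero_le_one) _) (by positivity)

lemma frequency_Iic {n : ℕ} (y : Fin n → ℝ) (t : ℝ) :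
    frequency y (Iic t) = (rank y t : ℝ) / n := by
  simp only [frequency, rank, indicator_apply, mem_Iic, Finset.sum_boole]
  rw [one_div_mul_eq_div]

lemma frequency_Iic_add_Ioi {n : ℕ} (hn : 0 < n) (y : Fin n → ℝ) (t : ℝ) :
    frequency y (Iic t) + frequency y (Ioi t) = 1 := by
  have hn' : (n : ℝ) ≠ 0 := by exact_mod_cast hn.ne'
  rw [frequency, frequency, ← mul_add, ← Finset.sum_add_distrib]
  have : ∀ i, (Iic t).indicator (fun _ => (1 : ℝ)) (y i) +
      (Ioi t).indicator (fun _ => (1 : ℝ)) (y i) = 1 := fun i => by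
    rcases le_or_gt (y i) t with h | h
    · simp [h]
    · simp [h]
  simp [this, hn']

/-- The level sets replace quantiles: `Iic t` lies in `{F < u}` for every `u` above `F t`, which
bounds the empirical distribution function from above. The same argument for `Ioi t` and the upper
tails gives the lower bound by complement. -/
lemma abs_rank_div_sub_le {m : Measure ℝ} [IsProbabilityMeasure m] {n N : ℕ} (hn : 0 < n)
    (hN : 0 < N) {y : Fin n → ℝ} {η : ℝ}
    (h1 : ∀ j ≤ N, frequency y {x | m.real (Iic x) < ((j : ℝ) + 1) / N} ≤ ((j : ℝ) + 1) / N + η)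
    (h2 : ∀ j ≤ N, frequency y {x | m.real (Ici x) < ((j : ℝ) + 1) / N} ≤ ((j : ℝ) + 1) / N + η)
    (t : ℝ) : |(rank y t : ℝ) / n - m.real (Iic t)| ≤ 1 / N + η := by
  have hN' : (0 : ℝ) < N := by exact_mod_cast hN
  have hfloor : ∀ p : ℝ, 0 ≤ p → p ≤ 1 →
      ∃ j ≤ N, p < ((j : ℝ) + 1) / N ∧ ((j : ℝ) + 1) / N ≤ p + 1 / N := by
    intro p hp0 hp1
    -- The next grid point strictly above `p`, which may exceed `1`.
    refine ⟨⌊(N : ℝ) * p⌋₊, Nat.floor_le_of_le (mul_le_of_le_one_right hN'.le hp1), ?_, ?_⟩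
    · rw [lt_div_iff₀ hN', mul_comm]; exact Nat.lt_floor_add_one _
    · rw [div_le_iff₀ hN', add_mul, one_div_mul_cancel hN'.ne', mul_comm p]
      exact add_le_add_left (Nat.floor_le (mul_nonneg hN'.le hp0)) 1
  rw [← frequency_Iic, abs_le]
  have hcompl : m.real (Ioi t) = 1 - m.real (Iic t) := by
    rw [← compl_Iic, probReal_compl_eq_one_sub measurableSet_Iic]
  constructor
  · obtain ⟨j, hj, hlt, hle⟩ := hfloor (m.real (Ioi t)) measureReal_nonneg measureReal_le_one
    have := (frequency_mono y (S := Ioi t) fun x hx =>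
      (measureReal_mono (Ici_subset_Ioi.2 hx)).trans_lt hlt).trans (h2 j hj)
    linarith [frequency_Iic_add_Ioi hn y t]
  · obtain ⟨j, hj, hlt, hle⟩ := hfloor (m.real (Iic t)) measureReal_nonneg measureReal_le_one
    have := (frequency_mono y (S := Iic t) fun x hx =>
      (measureReal_mono (Iic_subset_Iic.2 hx)).trans_lt hlt).trans (h1 j hj)
    linarith

variable {Ω : Type*} {mΩ : MeasurableSpace Ω} {P : Measure Ω} [IsProbabilityMeasure P]
  {μ : Measure (ℝ × ℝ)} {Xs Ys : ℕ → Ω → ℝ}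

lemma IsIIDSample.ae_tendsto_frequency (hZ : IsIIDSample P μ Xs Ys) {S : Set ℝ}
    (hS : MeasurableSet S) :
    ∀ᵐ ω ∂P, Tendsto (fun n : ℕ => frequency (fun i : Fin n => Ys i ω) S) atTop
      (𝓝 ((μ.map Prod.snd).real S)) := by
  have := hZ.isProbabilityMeasure
  have hm : Measurable fun p : ℝ × ℝ => S.indicator (fun _ => (1 : ℝ)) p.2 :=
    (measurable_const.indicator hS).comp measurable_snd
  have h := hZ.ae_tendsto_mean hm (integrable_of_abs_le (C := 1) hm fun p => by
    by_cases hp : p.2 ∈ S <;> simp [hp])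
  rwa [← integral_map (φ := Prod.snd) (f := S.indicator fun _ => (1 : ℝ))
    measurable_snd.aemeasurable (measurable_const.indicator hS).aestronglyMeasurable,
    integral_indicator_const _ hS, smul_eq_mul, mul_one] at h

/-- The Glivenko–Cantelli theorem for the second coordinates. -/
lemma IsIIDSample.ae_eventually_abs_rank_sub_le (hZ : IsIIDSample P μ Xs Ys) :
    ∀ᵐ ω ∂P, ∀ ε > 0, ∀ᶠ n : ℕ in atTop, ∀ t,
      |(rank (fun i : Fin n => Ys i ω) t : ℝ) / n - (μ.map Prod.snd).real (Iic t)| ≤ ε := by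
  have := hZ.isProbabilityMeasure
  set m := μ.map Prod.snd
  have : IsProbabilityMeasure m :=
    Measure.isProbabilityMeasure_map measurable_snd.aemeasurable
  have h1 : ∀ᵐ ω ∂P, ∀ N j : ℕ, Tendsto (fun n : ℕ => frequency (fun i : Fin n => Ys i ω)
      {x | m.real (Iic x) < ((j : ℝ) + 1) / N}) atTop
      (𝓝 (m.real {x | m.real (Iic x) < ((j : ℝ) + 1) / N})) :=
    ae_all_iff.2 fun N => ae_all_iff.2 fun j => hZ.ae_tendsto_frequency
      (measurableSet_lt (measurable_measureReal_Iic m) measurable_const)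
  have h2 : ∀ᵐ ω ∂P, ∀ N j : ℕ, Tendsto (fun n : ℕ => frequency (fun i : Fin n => Ys i ω)
      {x | m.real (Ici x) < ((j : ℝ) + 1) / N}) atTop
      (𝓝 (m.real {x | m.real (Ici x) < ((j : ℝ) + 1) / N})) :=
    ae_all_iff.2 fun N => ae_all_iff.2 fun j => hZ.ae_tendsto_frequency
      (measurableSet_lt (measurable_measureReal_Ici m) measurable_const)
  filter_upwards [h1, h2] with ω hω1 hω2 ε hε
  obtain ⟨k, hk⟩ := exists_nat_one_div_lt (half_pos hε)
  have hev1 : ∀ᶠ n : ℕ in atTop, ∀ j ≤ k + 1, frequency (fun i : Fin n => Ys i ω)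
      {x | m.real (Iic x) < ((j : ℝ) + 1) / (k + 1 : ℕ)} ≤
        ((j : ℝ) + 1) / (k + 1 : ℕ) + ε / 2 := by
    refine (Set.finite_Iic (k + 1)).eventually_all.2 fun j _ => ?_
    exact ((hω1 (k + 1) j).eventually_le_const ((measureReal_setOf_measureReal_Iic_lt_le m
      (by positivity)).trans_lt (lt_add_of_pos_right _ (half_pos hε))))
  have hev2 : ∀ᶠ n : ℕ in atTop, ∀ j ≤ k + 1, frequency (fun i : Fin n => Ys i ω)
      {x | m.real (Ici x) < ((j : ℝ) + 1) / (k + 1 : ℕ)} ≤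
        ((j : ℝ) + 1) / (k + 1 : ℕ) + ε / 2 := by
    refine (Set.finite_Iic (k + 1)).eventually_all.2 fun j _ => ?_
    exact ((hω2 (k + 1) j).eventually_le_const ((measureReal_setOf_measureReal_Ici_lt_le m
      (by positivity)).trans_lt (lt_add_of_pos_right _ (half_pos hε))))
  filter_upwards [hev1, hev2, eventually_gt_atTop 0] with n hn1 hn2 hn0 t
  have := abs_rank_div_sub_le (m := m) hn0 k.succ_pos hn1 hn2 t
  push_cast at this
  linarith

end RankCorr

/-! ### From ranks to `F`, positivity, and the limits -/

namespace RankCorr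

lemma abs_mean_adjacentSum_sub_le {n : ℕ} {q r : Fin n → Fin n → ℝ} {C : ℝ} (hC : 0 ≤ C)
    (h : ∀ a b, |q a b - r a b| ≤ C) (s : Equiv.Perm (Fin n)) :
    |(1 / (n : ℝ)) * adjacentSum q s - (1 / (n : ℝ)) * adjacentSum r s| ≤ C := by
  rw [← mul_sub, ← adjacentSum_sub, abs_mul, abs_of_nonneg (one_div_nonneg.2 n.cast_nonneg),
    one_div_mul_eq_div]
  exact div_le_of_le_mul₀ n.cast_nonneg hC (((abs_adjacentSum_le _ _).trans
    (adjacentSum_mono h s)).trans ((adjacentSum_const_le hC s).trans_eq (mul_comm _ _)))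

lemma abs_mean_sum_sum_sub_le {n : ℕ} {q r : Fin n → Fin n → ℝ} {C : ℝ} (hC : 0 ≤ C)
    (h : ∀ a b, |q a b - r a b| ≤ C) :
    |(1 / (n : ℝ) ^ 2) * ∑ i, ∑ j, q i j - (1 / (n : ℝ) ^ 2) * ∑ i, ∑ j, r i j| ≤ C := by
  rw [← mul_sub, abs_mul, abs_of_nonneg (by positivity), one_div_mul_eq_div]
  refine div_le_of_le_mul₀ (by positivity) hC ?_
  simp_rw [← Finset.sum_sub_distrib]
  refine (Finset.abs_sum_le_sum_abs _ _).trans ((Finset.sum_le_sum fun i _ =>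
    (Finset.abs_sum_le_sum_abs _ _).trans (Finset.sum_le_sum fun j _ => h i j)).trans_eq ?_)
  simp only [Finset.sum_const, Finset.card_univ, Fintype.card_fin, nsmul_eq_mul]
  ring

lemma rank_div_mem_Icc {n : ℕ} (y : Fin n → ℝ) (t : ℝ) :
    (rank y t : ℝ) / n ∈ Icc (0 : ℝ) 1 :=
  div_mem_Icc_of_le ((Finset.card_le_univ _).trans_eq (Fintype.card_fin n))

/-- If the empirical distribution functions of a sequence of samples converge uniformly to `F`,
then ranks can be replaced by `F` in statistics that are averages of values of `h`. -/
lemma tendsto_of_tendsto_comp {h : ℝ → ℝ → ℝ} (hlip : LipschitzCondition h) {F : ℝ → ℝ}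
    (hF : ∀ y, F y ∈ Icc (0 : ℝ) 1) {y : (n : ℕ) → Fin n → ℝ}
    (hy : ∀ ε > 0, ∀ᶠ n : ℕ in atTop, ∀ t, |(rank (y n) t : ℝ) / n - F t| ≤ ε)
    {A : (n : ℕ) → (Fin n → Fin n → ℝ) → ℝ}
    (hA : ∀ (n : ℕ) (q r : Fin n → Fin n → ℝ) (C : ℝ), 0 ≤ C → (∀ a b, |q a b - r a b| ≤ C) →
      |A n q - A n r| ≤ C) {l : ℝ}
    (hl : Tendsto (fun n => A n fun a b => h (F (y n a)) (F (y n b))) atTop (𝓝 l)) :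
    Tendsto (fun n => A n fun a b => h ((rank (y n) (y n a) : ℝ) / n)
      ((rank (y n) (y n b) : ℝ) / n)) atTop (𝓝 l) := by
  obtain ⟨K, hK0, hK⟩ := hlip
  refine hl.congr_dist (tendsto_order.2 ⟨fun a ha => Eventually.of_forall fun n =>
    ha.trans_le dist_nonneg, fun a ha => ?_⟩)
  -- Both arguments of `h` move by at most `a / (4 * K)`, so `h` moves by at most `a / 2`.
  filter_upwards [hy (a / (4 * K)) (by positivity)] with n hn
  rw [dist_comm, Real.dist_eq]
  refine (hA n _ _ (a / 2) (by positivity) fun i j => ?_).trans_lt (half_lt_self ha)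
  refine (hK _ (rank_div_mem_Icc _ _) _ (rank_div_mem_Icc _ _) _ (hF _) _ (hF _)).trans ?_
  refine (mul_le_mul_of_nonneg_left (add_le_add (hn _) (hn _)) hK0.le).trans_eq ?_
  field_simp
  ring

lemma cdf_mem_Icc (m : Measure ℝ) (y : ℝ) : cdf m y ∈ Icc (0 : ℝ) 1 :=
  ⟨cdf_nonneg m y, cdf_le_one m y⟩

/-- If `c < 1`, the level set `{F < (c + 1) / 2}` would have full mass, yet its mass is at most `(c
+ 1) / 2`. So `Iic z` has full mass for almost every `z`; exchanging the two variables by Fubini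
yields a point that is almost surely both an upper and a lower bound. -/
lemma exists_ae_eq_of_ae_cdf_eq {m : Measure ℝ} [IsProbabilityMeasure m] {c : ℝ}
    (hc : ∀ᵐ y ∂m, cdf m y = c) : ∃ w, ∀ᵐ y ∂m, y = w := by
  simp_rw [cdf_eq_real] at hc
  have hc1 : 1 ≤ c := by
    by_contra! hlt
    obtain ⟨y, hy⟩ := hc.exists
    have hc0 : 0 ≤ c := hy ▸ measureReal_nonneg
    have h1 := measureReal_setOf_measureReal_Iic_lt_le m (u := (c + 1) / 2) (by linarith)
    have h2 : m.real {y | m.real (Iic y) < (c + 1) / 2} = 1 := by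
      rw [measureReal_def, (mem_ae_iff_prob_eq_one
        (measurableSet_lt (measurable_measureReal_Iic m) measurable_const)).1, ENNReal.toReal_one]
      filter_upwards [hc] with y hy
      simp only [hy]
      linarith
    linarith
  have h1 : ∀ᵐ z ∂m, ∀ᵐ y ∂m, y ≤ z := by
    filter_upwards [hc] with z hz
    have h2 : m.real (Iic z)ᶜ = 0 := by
      rw [probReal_compl_eq_one_sub measurableSet_Iic]
      linarith [measureReal_nonneg (μ := m) (s := (Iic z)ᶜ),
        probReal_compl_eq_one_sub (μ := m) (measurableSet_Iic (a := z))]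
    exact (measureReal_eq_zero_iff).1 h2
  have h2 : ∀ᵐ y ∂m, ∀ᵐ z ∂m, y ≤ z :=
    (Measure.ae_ae_comm (p := fun z y => y ≤ z)
      (measurableSet_le measurable_snd measurable_fst)).1 h1
  obtain ⟨w, hw1, hw2⟩ := (h1.and h2).exists
  refine ⟨w, ?_⟩
  filter_upwards [hw1, hw2] with y hy1 hy2 using le_antisymm hy1 hy2

variable {Ω : Type*} {mΩ : MeasurableSpace Ω} {P : Measure Ω} [IsProbabilityMeasure P]
  {h : ℝ → ℝ → ℝ}

lemma RegularityCondition.measurable_comp (hreg : RegularityCondition h) {F : ℝ → ℝ}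
    (hFm : Measurable F) (hF : ∀ y, F y ∈ Icc (0 : ℝ) 1) :
    Measurable fun p : ℝ × ℝ => h (F p.1) (F p.2) :=
  measurable_comp_of_continuousOn hreg.continuousOn (f := fun p : ℝ × ℝ => (F p.1, F p.2))
    (by fun_prop) fun p => ⟨hF _, hF _⟩

lemma RegularityCondition.integrable_comp (hreg : RegularityCondition h) {F : ℝ → ℝ}
    (hFm : Measurable F) (hF : ∀ y, F y ∈ Icc (0 : ℝ) 1) (L : Measure (ℝ × ℝ))
    [IsProbabilityMeasure L] : Integrable (fun p : ℝ × ℝ => h (F p.1) (F p.2)) L := by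
  obtain ⟨C, -, hC⟩ := hreg.exists_abs_le
  exact integrable_of_abs_le (hreg.measurable_comp hFm hF) fun p => hC _ (hF _) _ (hF _)

lemma normalizationLimit_eq_integral_prod (hreg : RegularityCondition h) {F : ℝ → ℝ}
    (hFm : Measurable F) (hF : ∀ y, F y ∈ Icc (0 : ℝ) 1) {Y : Ω → ℝ} (hY : Measurable Y) :
    normalizationLimit P h F Y = ∫ p, h (F p.1) (F p.2) ∂((P.map Y).prod (P.map Y)) := by
  have := Measure.isProbabilityMeasure_map (μ := P) hY.aemeasurable
  rw [normalizationLimit, integral_prod_symm _ (hreg.integrable_comp hFm hF _)]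

/-- The measure on the right is the law of two copies of `Y` that are conditionally independent
given `X`. A single integral over the plane is the form that `tendsto_of_tendsto_mul` requires. -/
lemma variationLimit_eq_integral (hreg : RegularityCondition h) {F : ℝ → ℝ}
    (hFm : Measurable F) (hF : ∀ y, F y ∈ Icc (0 : ℝ) 1) {X Y : Ω → ℝ} (hX : Measurable X) :
    variationLimit P h F X Y = ∫ p, h (F p.1) (F p.2)
      ∂((P.map X ⊗ₘ (condDistrib Y X P ×ₖ condDistrib Y X P)).map Prod.snd) := by
  have := Measure.isProbabilityMeasure_map (μ := P) hX.aemeasurable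
  have hm := hreg.measurable_comp hFm hF
  obtain ⟨C, -, hC⟩ := hreg.exists_abs_le
  have hint : Integrable (fun p : ℝ × ℝ × ℝ => h (F p.2.1) (F p.2.2))
      (P.map X ⊗ₘ (condDistrib Y X P ×ₖ condDistrib Y X P)) :=
    integrable_of_abs_le (hm.comp measurable_snd) fun p => hC _ (hF _) _ (hF _)
  rw [integral_map measurable_snd.aemeasurable hm.aestronglyMeasurable,
    Measure.integral_compProd hint, variationLimit]
  congr 1
  funext x
  rw [Kernel.prod_apply, integral_prod_symm _ (hreg.integrable_comp hFm hF _)]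

/-- A zero integral of the nonnegative `h` forces `h (F y) (F z) = 0` almost everywhere; positivity
of `h` off the diagonal then makes `F` constant almost everywhere. -/
lemma normalizationLimit_pos (hreg : RegularityCondition h) {Y : Ω → ℝ} (hY : Measurable Y)
    (hYconst : ¬ ∃ c : ℝ, ∀ᵐ ω ∂P, Y ω = c) : 0 < normalizationLimit P h (cdf (P.map Y)) Y := by
  have := Measure.isProbabilityMeasure_map (μ := P) hY.aemeasurable
  have hF := cdf_mem_Icc (P.map Y)
  have hFm : Measurable (cdf (P.map Y)) := (monotone_cdf _).measurable
  rw [normalizationLimit_eq_integral_prod hreg hFm hF hY]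
  have hnn : ∀ p : ℝ × ℝ, 0 ≤ h (cdf (P.map Y) p.1) (cdf (P.map Y) p.2) :=
    fun p => hreg.nonneg _ (hF _) _ (hF _)
  refine lt_of_le_of_ne (integral_nonneg hnn) fun h0 => hYconst ?_
  have h1 := (integral_eq_zero_iff_of_nonneg hnn (hreg.integrable_comp hFm hF _)).1 h0.symm
  obtain ⟨y, hy⟩ := (Measure.ae_ae_of_ae_prod h1).exists
  obtain ⟨w, hw⟩ := exists_ae_eq_of_ae_cdf_eq (m := P.map Y) (c := cdf (P.map Y) y) (by
    filter_upwards [hy] with z hz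
    by_contra hne
    exact (hreg.pos _ (hF y) _ (hF z) (Ne.symm hne)).ne' hz)
  exact ⟨w, ae_of_ae_map hY.aemeasurable hw⟩

variable {Xs Ys : ℕ → Ω → ℝ} {X Y : Ω → ℝ}

lemma IsIIDSample.ae_tendsto_rankVariation
    (hZ : IsIIDSample P (P.map X ⊗ₘ condDistrib Y X P) Xs Ys) (hX : Measurable X)
    (hY : Measurable Y) (hreg : RegularityCondition h) (hlip : LipschitzCondition h)
    {s : (n : ℕ) → Ω → Equiv.Perm (Fin n)}
    (hs : ∀ n, IsRandomSorting P (fun i : Fin n => Xs i) (fun i : Fin n => Ys i) (s n)) :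
    ∀ᵐ ω ∂P, Tendsto (fun n : ℕ => rankVariation h (fun i : Fin n => Ys i ω) (s n ω)) atTop
      (𝓝 (variationLimit P h (cdf (P.map Y)) X Y)) := by
  have := Measure.isProbabilityMeasure_map (μ := P) hX.aemeasurable
  have := Measure.isProbabilityMeasure_map (μ := P) hY.aemeasurable
  have hF := cdf_mem_Icc (P.map Y)
  have hFm : Measurable (cdf (P.map Y)) := (monotone_cdf _).measurable
  set F : ℝ → ℝ := ⇑(cdf (P.map Y))
  obtain ⟨C, hC1, hC⟩ := hreg.exists_abs_le
  have hsnd : (P.map X ⊗ₘ condDistrib Y X P).map Prod.snd = P.map Y := by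
    rw [compProd_map_condDistrib hY.aemeasurable,
      Measure.map_map measurable_snd (hX.prodMk hY)]
    rfl
  have hprob : IsProbabilityMeasure
      ((P.map X ⊗ₘ (condDistrib Y X P ×ₖ condDistrib Y X P)).map Prod.snd) :=
    Measure.isProbabilityMeasure_map measurable_snd.aemeasurable
  -- Only countably many products occur, so one null set serves for all of them.
  have hprod : ∀ N k : ℕ, ∀ᵐ ω ∂P, k ≤ N → Tendsto (fun n : ℕ => (1 / (n : ℝ)) *
      adjacentSum (fun a b : Fin n => (if ⌊(N : ℝ) * F (Ys a ω)⌋₊ = k then 1 else 0) *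
        h (k / N) (F (Ys b ω))) (s n ω)) atTop
      (𝓝 (∫ p, (if ⌊(N : ℝ) * F p.1⌋₊ = k then 1 else 0) * h (k / N) (F p.2)
        ∂((P.map X ⊗ₘ (condDistrib Y X P ×ₖ condDistrib Y X P)).map Prod.snd))) := by
    intro N k
    by_cases hk : k ≤ N
    swap
    · exact ae_of_all _ fun ω h' => absurd h' hk
    have hφ := measurable_ite_floor_eq hFm N k
    have hψ : Measurable fun y => h (k / N) (F y) :=
      measurable_comp_of_continuousOn hreg.continuousOn (f := fun y => ((k / N : ℝ), F y))
        (by fun_prop) fun y => ⟨div_mem_Icc_of_le hk, hF y⟩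
    have hφC : ∀ y, |if ⌊(N : ℝ) * F y⌋₊ = k then (1 : ℝ) else 0| ≤ C := fun y => by
      split_ifs <;> simp [hC1, zero_le_one.trans hC1]
    have hψC : ∀ y, |h (k / N) (F y)| ≤ C := fun y => hC _ (div_mem_Icc_of_le hk) _ (hF y)
    have hm : Measurable fun p : ℝ × ℝ =>
        (if ⌊(N : ℝ) * F p.1⌋₊ = k then 1 else 0) * h (k / N) (F p.2) :=
      (hφ.comp measurable_fst).mul (hψ.comp measurable_snd)
    have hlimit : ∫ p, (if ⌊(N : ℝ) * F p.1⌋₊ = k then 1 else 0) * h (k / N) (F p.2)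
        ∂((P.map X ⊗ₘ (condDistrib Y X P ×ₖ condDistrib Y X P)).map Prod.snd) =
        ∫ x, (∫ y, (if ⌊(N : ℝ) * F y⌋₊ = k then (1 : ℝ) else 0) ∂(condDistrib Y X P x)) *
          (∫ y, h (k / N) (F y) ∂(condDistrib Y X P x)) ∂(P.map X) := by
      have hint : Integrable (fun p : ℝ × ℝ × ℝ =>
          (if ⌊(N : ℝ) * F p.2.1⌋₊ = k then 1 else 0) * h (k / N) (F p.2.2))
          (P.map X ⊗ₘ (condDistrib Y X P ×ₖ condDistrib Y X P)) := by
        refine integrable_of_abs_le (C := C * C) (hm.comp measurable_snd) fun p => ?_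
        rw [abs_mul]
        exact mul_le_mul (hφC _) (hψC _) (abs_nonneg _) (zero_le_one.trans hC1)
      rw [integral_map measurable_snd.aemeasurable hm.aestronglyMeasurable,
        Measure.integral_compProd hint]
      congr 1
      funext x
      rw [Kernel.prod_apply]
      exact integral_prod_mul (fun y => if ⌊(N : ℝ) * F y⌋₊ = k then (1 : ℝ) else 0)
        fun y => h (k / N) (F y)
    rw [hlimit]
    filter_upwards [hZ.ae_tendsto_adjacent_mul hs hφ hψ hφC hψC] with ω hω _ using hω
  have hgc := hZ.ae_eventually_abs_rank_sub_le
  simp_rw [hsnd, ← cdf_eq_real] at hgc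
  filter_upwards [ae_all_iff.2 fun N => ae_all_iff.2 fun k => hprod N k, hgc] with ω hω hgcω
  rw [variationLimit_eq_integral hreg hFm hF hX]
  refine tendsto_of_tendsto_comp hlip hF (y := fun n (i : Fin n) => Ys i ω) hgcω
    (A := fun n q => (1 / (n : ℝ)) * adjacentSum q (s n ω))
    (fun n q r D hD hqr => abs_mean_adjacentSum_sub_le hD hqr _) ?_
  refine tendsto_of_tendsto_mul hreg hlip hFm hF
    (A := fun n q => (1 / (n : ℝ)) * adjacentSum (fun a b : Fin n => q (Ys a ω) (Ys b ω)) (s n ω))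
    (fun n N q => ?_) (fun n q r D hqr => ?_) fun N k hk => hω N k hk
  · rw [adjacentSum_sum, Finset.mul_sum]
  · exact abs_mean_adjacentSum_sub_le ((abs_nonneg _).trans (hqr 0 0)) (fun a b => hqr _ _) _

lemma IsIIDSample.ae_tendsto_rankNormalization {μ : Measure (ℝ × ℝ)} (hZ : IsIIDSample P μ Xs Ys)
    (hμ : μ.map Prod.snd = P.map Y) (hY : Measurable Y) (hreg : RegularityCondition h)
    (hlip : LipschitzCondition h) :
    ∀ᵐ ω ∂P, Tendsto (fun n : ℕ => rankNormalization h (fun i : Fin n => Ys i ω)) atTop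
      (𝓝 (normalizationLimit P h (cdf (P.map Y)) Y)) := by
  have := hZ.isProbabilityMeasure
  have := Measure.isProbabilityMeasure_map (μ := P) hY.aemeasurable
  have hF := cdf_mem_Icc (P.map Y)
  have hFm : Measurable (cdf (P.map Y)) := (monotone_cdf _).measurable
  set F : ℝ → ℝ := ⇑(cdf (P.map Y))
  obtain ⟨C, hC1, hC⟩ := hreg.exists_abs_le
  have hmean : ∀ {f : ℝ → ℝ}, Measurable f → (∀ y, |f y| ≤ C) → ∀ᵐ ω ∂P,
      Tendsto (fun n : ℕ => (1 / (n : ℝ)) * ∑ i : Fin n, f (Ys i ω)) atTop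
        (𝓝 (∫ y, f y ∂(P.map Y))) := by
    intro f hf hfC
    rw [← hμ, integral_map measurable_snd.aemeasurable hf.aestronglyMeasurable]
    exact hZ.ae_tendsto_mean (f := fun p => f p.2) (by fun_prop)
      (integrable_of_abs_le (by fun_prop) fun p => hfC _)
  have hprod : ∀ N k : ℕ, ∀ᵐ ω ∂P, k ≤ N → Tendsto (fun n : ℕ => (1 / (n : ℝ) ^ 2) *
      ∑ a : Fin n, ∑ b : Fin n, (if ⌊(N : ℝ) * F (Ys a ω)⌋₊ = k then 1 else 0) *
        h (k / N) (F (Ys b ω))) atTop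
      (𝓝 (∫ p, (if ⌊(N : ℝ) * F p.1⌋₊ = k then 1 else 0) * h (k / N) (F p.2)
        ∂((P.map Y).prod (P.map Y)))) := by
    intro N k
    by_cases hk : k ≤ N
    swap
    · exact ae_of_all _ fun ω h' => absurd h' hk
    have hψ : Measurable fun y => h (k / N) (F y) :=
      measurable_comp_of_continuousOn hreg.continuousOn (f := fun y => ((k / N : ℝ), F y))
        (by fun_prop) fun y => ⟨div_mem_Icc_of_le hk, hF y⟩
    have hφC : ∀ y, |if ⌊(N : ℝ) * F y⌋₊ = k then (1 : ℝ) else 0| ≤ C := fun y => by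
      split_ifs <;> simp [hC1, zero_le_one.trans hC1]
    rw [integral_prod_mul (fun y => if ⌊(N : ℝ) * F y⌋₊ = k then (1 : ℝ) else 0)
        fun y => h (k / N) (F y)]
    filter_upwards [hmean (measurable_ite_floor_eq hFm N k) hφC,
      hmean hψ fun y => hC _ (div_mem_Icc_of_le hk) _ (hF y)] with ω h1 h2 _
    -- The double sum of a product, diagonal included, is exactly a product of two means.
    refine (h1.mul h2).congr fun n => ?_
    rw [mul_mul_mul_comm, Finset.sum_mul_sum, ← sq, one_div_pow]
  have hgc := hZ.ae_eventually_abs_rank_sub_le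
  simp_rw [hμ, ← cdf_eq_real] at hgc
  filter_upwards [ae_all_iff.2 fun N => ae_all_iff.2 fun k => hprod N k, hgc] with ω hω hgcω
  rw [normalizationLimit_eq_integral_prod hreg hFm hF hY]
  refine tendsto_of_tendsto_comp hlip hF (y := fun n (i : Fin n) => Ys i ω) hgcω
    (A := fun n q => (1 / (n : ℝ) ^ 2) * ∑ i, ∑ j, q i j)
    (fun n q r D hD hqr => abs_mean_sum_sum_sub_le hD hqr) ?_
  refine tendsto_of_tendsto_mul hreg hlip hFm hF
    (A := fun n q => (1 / (n : ℝ) ^ 2) * ∑ a : Fin n, ∑ b : Fin n, q (Ys a ω) (Ys b ω))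
    (fun n N q => ?_) (fun n q r D hqr => ?_) fun N k hk => hω N k hk
  · rw [← Finset.mul_sum]
    congr 1
    exact (Finset.sum_congr rfl fun i _ => Finset.sum_comm).trans Finset.sum_comm
  · exact abs_mean_sum_sum_sub_le ((abs_nonneg _).trans (hqr 0 0)) fun a b => hqr _ _

end RankCorr

theorem theorem5 {Ω : Type*} [MeasurableSpace Ω] (P : Measure Ω) [IsProbabilityMeasure P]
    (h : ℝ → ℝ → ℝ) (hreg : RankCorr.RegularityCondition h)
    (hlip : RankCorr.LipschitzCondition h)
    (X Y : Ω → ℝ) (hX : Measurable X) (hY : Measurable Y)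
    (hXconst : ¬ ∃ c : ℝ, ∀ᵐ ω ∂P, X ω = c) (hYconst : ¬ ∃ c : ℝ, ∀ᵐ ω ∂P, Y ω = c)
    (Xs Ys : ℕ → Ω → ℝ) (hXs : ∀ i, Measurable (Xs i)) (hYs : ∀ i, Measurable (Ys i))
    (hindep : iIndepFun (fun (i : ℕ) (ω : Ω) => (Xs i ω, Ys i ω)) P)
    (hident : ∀ i, IdentDistrib (fun ω => (Xs i ω, Ys i ω)) (fun ω => (X ω, Y ω)) P P)
    (s : (n : ℕ) → Ω → Equiv.Perm (Fin n))
    (hs : ∀ n, RankCorr.IsRandomSorting P (fun i : Fin n => Xs i) (fun i : Fin n => Ys i) (s n)) :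
    (∀ᵐ ω ∂P, Tendsto
      (fun n : ℕ => RankCorr.rankVariation h (fun i : Fin n => Ys i ω) (s n ω)) atTop
      (𝓝 (RankCorr.variationLimit P h (cdf (P.map Y)) X Y))) ∧
    (0 < RankCorr.normalizationLimit P h (cdf (P.map Y)) Y ∧
      ∀ᵐ ω ∂P, Tendsto
        (fun n : ℕ => RankCorr.rankNormalization h (fun i : Fin n => Ys i ω)) atTop
        (𝓝 (RankCorr.normalizationLimit P h (cdf (P.map Y)) Y))) ∧
    (∀ᵐ ω ∂P, Tendsto
      (fun n : ℕ => RankCorr.rankCoefficient h (fun i : Fin n => Ys i ω) (s n ω)) atTop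
      (𝓝 (RankCorr.correlationMeasure P h (cdf (P.map Y)) X Y))) := by 
  have hμ : P.map X ⊗ₘ condDistrib Y X P = P.map fun ω => (X ω, Y ω) :=
    compProd_map_condDistrib hY.aemeasurable
  have hZ : RankCorr.IsIIDSample P (P.map X ⊗ₘ condDistrib Y X P) Xs Ys :=
    ⟨hXs, hYs, hindep, fun i => (hident i).map_eq.trans hμ.symm⟩
  have hsnd : (P.map X ⊗ₘ condDistrib Y X P).map Prod.snd = P.map Y := by
    rw [hμ, Measure.map_map measurable_snd (hX.prodMk hY)]
    rfl
  have hvar := hZ.ae_tendsto_rankVariation hX hY hreg hlip hs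
  have hnorm := hZ.ae_tendsto_rankNormalization hsnd hY hreg hlip
  have hpos := RankCorr.normalizationLimit_pos hreg hY hYconst
  refine ⟨hvar, ⟨hpos, hnorm⟩, ?_⟩
  filter_upwards [hvar, hnorm] with ω h1 h2
  rw [RankCorr.correlationMeasure, if_neg hpos.ne']
  refine ((h1.div h2 hpos.ne').const_sub 1).congr' ?_
  -- The normalization is eventually nonzero, so the default value `1` plays no role in the limit.
  filter_upwards [h2.eventually_ne hpos.ne'] with n hn
  rw [RankCorr.rankCoefficient, if_neg hn]
  rfl
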